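/- Notation. Let $\langle u,v\rangle=\int_{\mathbb R^d}u\,\overline{v}\,dx$ and $\|\cdot\|$ be the inner product and norm of $L^2(\mathbb R^d,\mathbb C)$. For an operator $A:D(A)\to L^2(\mathbb R^d,\mathbb C)$ put $\|u\|_A=\|u\|+\|Au\|$; balls in $D(A)$ are taken in this norm. For $W:\mathbb R^d\times\mathbb C\to\mathbb C$ put $L(\cdot,\omega)=A-W(\cdot,\omega)$ with domain $D(A)$. Assumptions. Let $\omega_0\in\mathbb C$, $\varphi_0\in D(A)$, and let $\delta,\alpha,\beta,\lambda_0>0$. (A1) $A$ is densely defined and closed and has a non-empty resolvent set. (A2) $D(A)\hookrightarrow L^\infty(\mathbb R^d,\mathbb C)$ continuously. (W1) $W(x,\cdot)$ is holomorphic on $B_\delta(\omega_0)$ for a.e. $x$, and $\|W(\cdot,\omega)\|_\infty\le c$ for some $c>0$ and all $\omega\in B_\delta(\omega_0)$. (E) $\omega_0$ is an algebraically simple eigenvalue, i.e. $\ker L(\cdot,\omega_0)^2=\ker L(\cdot,\omega_0)=\mathrm{span}\{\varphi_0\}$; it is isolated, i.e. for some $\rho>0$ and all $\omega\in B_\rho(\omega_0)$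 one has $0\in\sigma(L(\cdot,\omega))$ if and only if $\omega=\omega_0$; and $L(\cdot,\omega_0)$ has closed range. Moreover $\varphi_0^*$ is an eigenfunction of the adjoint, $L(\cdot,\omega_0)^*\varphi_0^*=0$, normalized together with $\varphi_0$ by $\|\varphi_0\|=1$, $\langle\varphi_0,\varphi_0^*\rangle=1$. (Wt) $\langle\partial_\omega W(\cdot,\omega_0)\varphi_0,\varphi_0^*\rangle\ne0$. The function $f:\mathbb R^d\times\mathbb C\times\mathbb C\to\mathbb C$ satisfies: (f1) $f(\cdot,\omega,\varphi(\cdot))\in L^2(\mathbb R^d,\mathbb C)$ for all $\omega\in B_\delta(\omega_0)$ and $\varphi\in B_\delta(0)\subset D(A)$. (f2) There is $K>0$ with $\|f(\cdot,\omega_1,\lambda\varphi)-f(\cdot,\omega_2,\lambda\varphi)\|\le K\lambda^{\frac1\alpha+1}|\omega_1-\omega_2|$ for all $\lambda\in(0,\lambda_0)$, $\omega_1,\omega_2\in B_\delta(\omega_0)$, $\varphi\in B_\delta(\varphi_0)\subset D(A)$. (f3) There is $K>0$ with $\|f(\cdot,\omega,\lambda\varphi_1)-f(\cdot,\omega,\lambda\varphi_2)\|\le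 K\lambda^{\frac1\alpha+1}\|\varphi_1-\varphi_2\|$ for all $\lambda\in(0,\lambda_0)$, $\varphi_1,\varphi_2\in B_\delta(\varphi_0)\subset D(A)$, $\omega\in B_\delta(\omega_0)$. (f4) For every $\omega\in B_\delta(\omega_0)$ there is $g_\omega\in L^\infty(\mathbb R^d,\mathbb C)\setminus\{0\}$ such that $f(x,\omega,z)-g_\omega(x)|z|^{\frac1\alpha}z=O(|z|^{\frac1\alpha+1+\beta})$ as $\mathbb C\ni z\to0$, uniformly in $\omega\in B_\delta(\omega_0)$ and in a.e. $x$, and $\|g_{\omega_1}-g_{\omega_2}\|_\infty\le K|\omega_1-\omega_2|$ for some $K>0$ and all $\omega_1,\omega_2\in B_\delta(\omega_0)$. Theorem. Put $$\nu=-\frac{\langle g_{\omega_0}|\varphi_0|^{\frac1\alpha}\varphi_0,\varphi_0^*\rangle}{\langle\partial_\omega W(\cdot,\omega_0)\varphi_0,\varphi_0^*\rangle}.$$ There is exactly one $\phi\in D(A)$ with $\langle\phi,\varphi_0^*\rangle=0$ and $L(\cdot,\omega_0)\phi=g_{\omega_0}|\varphi_0|^{\frac1\alpha}\varphi_0+\nu\,\partial_\omega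 W(\cdot,\omega_0)\varphi_0$. With these $\nu$ and $\phi$, for every $\tau\in(0,\min\{1,\alpha\beta\}]$ there are $r_1,r_2,\varepsilon_0>0$ such that for every $\varepsilon\in(0,\varepsilon_0)$ the problem $$L(\cdot,\omega)\varphi=f(\cdot,\omega,\varphi),\qquad\langle\varphi,\varphi_0^*\rangle=\varepsilon^\alpha,$$ has exactly one solution $(\omega,\varphi)\in\mathbb C\times D(A)$ of the form $$\omega=\omega_0+\varepsilon\nu+\varepsilon^{1+\tau}\sigma,\qquad\varphi=\varepsilon^\alpha\varphi_0+\varepsilon^{\alpha+1}\phi+\varepsilon^{\alpha+1+\tau}\psi$$ with $\sigma\in\mathbb C$, $|\sigma|<r_1$, and $\psi\in D(A)$, $\langle\psi,\varphi_0^*\rangle=0$, $\|\psi\|_A<r_2$. -/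

import Mathlib

open MeasureTheory
open scoped ENNReal LinearPMap

namespace NLEig

noncomputable section

/-- The space `ℝ^d`. -/
abbrev Rd (d : ℕ) : Type := EuclideanSpace ℝ (Fin d)

/-- The complex Hilbert space `L²(ℝ^d, ℂ)`. -/
abbrev L2 (d : ℕ) : Type := Lp ℂ 2 (volume : Measure (Rd d))

/-- Unbounded linear operators `L²(ℝ^d, ℂ) ⊇ D(T) → L²(ℝ^d, ℂ)`. -/
abbrev Op (d : ℕ) : Type := L2 d →ₗ.[ℂ] L2 d

/-- The pairing `⟨u, v⟩ = ∫ u v̄` of `L²(ℝ^d, ℂ)`, linear in the FIRST argument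
(Mathlib's `inner` is linear in the second one). -/
def pair {d : ℕ} (u v : L2 d) : ℂ := inner ℂ v u

open Classical in
/-- The bounded multiplication operator `u ↦ w u` on `L²(ℝ^d, ℂ)` for `w ∈ L^∞(ℝ^d, ℂ)`
(zero if `w` is not in `L^∞`). -/
def mulOp {d : ℕ} (w : Rd d → ℂ) : L2 d →L[ℂ] L2 d :=
  if h : MemLp w ∞ (volume : Measure (Rd d)) then
    (ContinuousLinearMap.mul ℂ ℂ).holderL volume ∞ 2 2 (h.toLp w)
  else 0

theorem mulOp_coeFn {d : ℕ} {w : Rd d → ℂ} (h : MemLp w ∞ (volume : Measure (Rd d)))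
    (u : L2 d) : (mulOp w u : Rd d → ℂ) =ᵐ[volume] fun x => w x * u x := by
  rw [mulOp, dif_pos h]
  refine ((ContinuousLinearMap.mul ℂ ℂ).coeFn_holder (r := 2) (h.toLp w) u).trans ?_
  filter_upwards [h.coeFn_toLp] with x hx
  simp [hx]

/-- The operator `L(·, ω) = A - W(·, ω)` with domain `D(A)`. -/
def linOp {d : ℕ} (A : Op d) (W : Rd d → ℂ → ℂ) (ω : ℂ) : Op d where
  domain := A.domain
  toFun := A.toFun - (mulOp fun x => W x ω).toLinearMap ∘ₗ A.domain.subtype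

/-- `z` belongs to the resolvent set of `T`: the operator `T - z : D(T) → L²` has a bounded,
everywhere defined two-sided inverse. -/
def InResolvent {d : ℕ} (T : Op d) (z : ℂ) : Prop :=
  ∃ R : L2 d →L[ℂ] L2 d,
    (∀ v : L2 d, ∃ h : R v ∈ T.domain, T ⟨R v, h⟩ - z • R v = v) ∧
    (∀ u : T.domain, R (T u - z • (u : L2 d)) = u)

/-- `z` belongs to the spectrum of `T`. -/
def InSpectrum {d : ℕ} (T : Op d) (z : ℂ) : Prop := ¬ InResolvent T z

/-- The graph norm `‖u‖_A = ‖u‖ + ‖A u‖` on `D(A)`. -/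
def graphNorm {d : ℕ} (A : Op d) (u : A.domain) : ℝ := ‖(u : L2 d)‖ + ‖A u‖

/-- `ker T = ker T² = ⟨φ₀⟩`, where `D(T²) = {u ∈ D(T) : T u ∈ D(T)}`. -/
def AlgSimple {d : ℕ} (T : Op d) (φ₀ : L2 d) : Prop :=
  {u : L2 d | ∃ h : u ∈ T.domain, T ⟨u, h⟩ = 0} = (Submodule.span ℂ {φ₀} : Set (L2 d)) ∧
  {u : L2 d | ∃ (h : u ∈ T.domain) (h' : T ⟨u, h⟩ ∈ T.domain), T ⟨T ⟨u, h⟩, h'⟩ = 0} =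
    (Submodule.span ℂ {φ₀} : Set (L2 d))

/-- `ω₀` is isolated: near `ω₀`, zero is in the spectrum of `L(·, ω)` if and only if `ω = ω₀`. -/
def Isolated {d : ℕ} (A : Op d) (W : Rd d → ℂ → ℂ) (ω₀ : ℂ) : Prop :=
  ∃ ρ > 0, ∀ ω ∈ Metric.ball ω₀ ρ, InSpectrum (linOp A W ω) 0 ↔ ω = ω₀

/-- `A` is closed, densely defined and has a non-empty resolvent set. -/
def HypA1 {d : ℕ} (A : Op d) : Prop :=
  Dense (A.domain : Set (L2 d)) ∧ A.IsClosed ∧ ∃ z, InResolvent A z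

/-- `D(A)` with the graph norm embeds continuously into `L^∞`. -/
def HypA2 {d : ℕ} (A : Op d) : Prop :=
  ∃ C : ℝ, ∀ u : A.domain,
    eLpNorm ((u : L2 d) : Rd d → ℂ) ∞ volume ≤ ENNReal.ofReal (C * graphNorm A u)

/-- `W(x, ·)` is holomorphic on `B_δ(ω₀)` for a.e. `x`, and `W(·, ω)` is bounded in `L^∞`
uniformly in `ω ∈ B_δ(ω₀)`. -/
def HypW1 {d : ℕ} (W : Rd d → ℂ → ℂ) (ω₀ : ℂ) (δ : ℝ) : Prop :=
  (∀ᵐ x : Rd d, DifferentiableOn ℂ (W x) (Metric.ball ω₀ δ)) ∧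
  ∃ c > 0, ∀ ω ∈ Metric.ball ω₀ δ,
    AEStronglyMeasurable (fun x => W x ω) volume ∧
    eLpNorm (fun x => W x ω) ∞ volume ≤ ENNReal.ofReal c

/-- The function `∂_ω W(·, ω₀)`. -/
def dW {d : ℕ} (W : Rd d → ℂ → ℂ) (ω₀ : ℂ) : Rd d → ℂ := fun x => deriv (W x) ω₀

/-- The superposition `f(·, ω, φ(·))` is in `L²` for `ω ∈ B_δ(ω₀)` and `φ ∈ B_δ(0) ⊆ D(A)`. -/
def HypF1 {d : ℕ} (A : Op d) (f : Rd d → ℂ → ℂ → ℂ) (ω₀ : ℂ) (δ : ℝ) : Prop :=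
  ∀ ω ∈ Metric.ball ω₀ δ, ∀ φ : A.domain, graphNorm A φ < δ →
    MemLp (fun x => f x ω ((φ : L2 d) x)) 2 volume

/-- Lipschitz continuity of `f` in `ω`. -/
def HypF2 {d : ℕ} (A : Op d) (f : Rd d → ℂ → ℂ → ℂ) (ω₀ : ℂ) (φ₀ : A.domain)
    (δ α lam₀ : ℝ) : Prop :=
  ∃ K > 0, ∀ lam ∈ Set.Ioo 0 lam₀,
    ∀ ω₁ ∈ Metric.ball ω₀ δ, ∀ ω₂ ∈ Metric.ball ω₀ δ,
    ∀ φ : A.domain, graphNorm A (φ - φ₀) < δ →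
      eLpNorm (fun x => f x ω₁ (lam * (φ : L2 d) x) - f x ω₂ (lam * (φ : L2 d) x)) 2 volume
        ≤ ENNReal.ofReal (K * lam ^ (1 / α + 1) * ‖ω₁ - ω₂‖)

/-- Lipschitz continuity of `f` in `φ`. -/
def HypF3 {d : ℕ} (A : Op d) (f : Rd d → ℂ → ℂ → ℂ) (ω₀ : ℂ) (φ₀ : A.domain)
    (δ α lam₀ : ℝ) : Prop :=
  ∃ K > 0, ∀ lam ∈ Set.Ioo 0 lam₀,
    ∀ φ₁ : A.domain, graphNorm A (φ₁ - φ₀) < δ →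
    ∀ φ₂ : A.domain, graphNorm A (φ₂ - φ₀) < δ →
    ∀ ω ∈ Metric.ball ω₀ δ,
      eLpNorm (fun x => f x ω (lam * (φ₁ : L2 d) x) - f x ω (lam * (φ₂ : L2 d) x)) 2 volume
        ≤ ENNReal.ofReal (K * lam ^ (1 / α + 1) * ‖(φ₁ : L2 d) - (φ₂ : L2 d)‖)

/-- `g_ω ∈ L^∞ \ {0}`; `f(x, ω, z) - g_ω(x)|z|^{1/α} z = O(|z|^{1/α+1+β})` as `z → 0`, uniformly
in `ω ∈ B_δ(ω₀)` and (up to null sets) in `x`; and `ω ↦ g_ω ∈ L^∞` is Lipschitz. -/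
def HypF4 {d : ℕ} (f : Rd d → ℂ → ℂ → ℂ) (g : ℂ → Rd d → ℂ) (ω₀ : ℂ) (δ α β : ℝ) : Prop :=
  (∀ ω ∈ Metric.ball ω₀ δ, MemLp (g ω) ∞ volume ∧ ¬ g ω =ᵐ[volume] 0) ∧
  (∃ C : ℝ, ∃ r > 0, ∀ ω ∈ Metric.ball ω₀ δ, ∀ᵐ x : Rd d, ∀ z : ℂ, ‖z‖ < r →
    ‖f x ω z - g ω x * ((‖z‖ ^ (1 / α) : ℝ) : ℂ) * z‖ ≤ C * ‖z‖ ^ (1 / α + 1 + β)) ∧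
  ∃ K > 0, ∀ ω₁ ∈ Metric.ball ω₀ δ, ∀ ω₂ ∈ Metric.ball ω₀ δ,
    eLpNorm (fun x => g ω₁ x - g ω₂ x) ∞ volume ≤ ENNReal.ofReal (K * ‖ω₁ - ω₂‖)

/-- The element `g |φ|^{1/α} φ` of `L²`, for `g ∈ L^∞` and `φ ∈ L² ∩ L^∞`. -/
def leading {d : ℕ} (g : Rd d → ℂ) (α : ℝ) (φ : L2 d) : L2 d :=
  mulOp (fun x => g x * ((‖φ x‖ ^ (1 / α) : ℝ) : ℂ)) φ

/-- `ν = - ⟨g_{ω₀}|φ₀|^{1/α} φ₀, φ₀*⟩ / ⟨∂_ω W(·, ω₀) φ₀, φ₀*⟩`. -/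
def nu {d : ℕ} (W : Rd d → ℂ → ℂ) (g : ℂ → Rd d → ℂ) (α : ℝ) (ω₀ : ℂ) (φ₀ φs : L2 d) : ℂ :=
  - pair (leading (g ω₀) α φ₀) φs / pair (mulOp (dW W ω₀) φ₀) φs

/-- `(ω, φ) ∈ ℂ × D(A)` solves `L(·, ω) φ = f(·, ω, φ)`. -/
def Solves {d : ℕ} (A : Op d) (W : Rd d → ℂ → ℂ) (f : Rd d → ℂ → ℂ → ℂ)
    (ω : ℂ) (φ : L2 d) : Prop :=
  ∃ h : φ ∈ (linOp A W ω).domain,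
    (linOp A W ω ⟨φ, h⟩ : Rd d → ℂ) =ᵐ[volume] fun x => f x ω (φ x)

/-- `ω = ω₀ + εν + ε^{1+τ}σ` and `φ = ε^α φ₀ + ε^{α+1} ϕ + ε^{α+1+τ} ψ` for some `σ ∈ B_{r₁}(0) ⊆ ℂ`
and some `ψ ∈ B_{r₂}(0) ⊆ D(A)` with `⟨ψ, φ₀*⟩ = 0`. -/
def HasExpansion {d : ℕ} (A : Op d) (ω₀ ν : ℂ) (φ₀ φs ϕ : L2 d) (α τ r₁ r₂ ε : ℝ)
    (ω : ℂ) (φ : L2 d) : Prop :=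
  ∃ (σ : ℂ) (ψ : A.domain), ‖σ‖ < r₁ ∧ graphNorm A ψ < r₂ ∧ pair (ψ : L2 d) φs = 0 ∧
    ω = ω₀ + (ε : ℂ) * ν + ((ε ^ (1 + τ) : ℝ) : ℂ) * σ ∧
    φ = ((ε ^ α : ℝ) : ℂ) • φ₀ + ((ε ^ (α + 1) : ℝ) : ℂ) • ϕ +
      ((ε ^ (α + 1 + τ) : ℝ) : ℂ) • (ψ : L2 d)

end

end NLEig

/-! Fix `ε > 0`, put `λ = ε ^ α` and write `ω = ω₀ + σ`, `φ = λ (φ₀ + u)` with `⟨u, φ₀*⟩ = 0`.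
Moving everything but the linearization at `(ω₀, φ₀)` to the right turns the problem into
`L(·, ω₀) u - σ ∂_ω W(·, ω₀) φ₀ = N_ε(σ, u)`, `⟨u, φ₀*⟩ = 0`.

The operator `(σ, u) ↦ (L(·, ω₀) u - σ ∂_ω W(·, ω₀) φ₀, ⟨u, φ₀*⟩)` on `ℂ × D(A)` is bijective. By
simplicity and transversality it is injective, and its range is closed. The same operators with
`L(·, ω)` in place of `L(·, ω₀)` are onto for `ω ≠ ω₀` near `ω₀`, because there `L(·, ω)` is
invertible, and surjectivity passes to the norm limit when the limit is bounded below.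

Let `S` be the inverse on `L² × {0}`. Then `S (g_{ω₀} |φ₀|^{1/α} φ₀) = (ν, ϕ)`, and the equation is
the fixed point problem `(σ, u) = S (N_ε(σ, u))`. On balls of radius `O(ε)` about `0` the map `N_ε`
has Lipschitz constant `O(ε)`, and `N_ε(0) = ε g_{ω₀} |φ₀|^{1/α} φ₀ + O(ε ^ (1 + α β))`, so
`S ∘ N_ε` has exactly one fixed point in the ball of radius `r ε ^ (1 + τ)` about `ε (ν, ϕ)`.
-/

namespace NLEig

noncomputable section

open Filter Topology
open scoped NNReal

section FixedPoint

theorem existsUnique_fixedPoint_mem_ball {E : Type*} [MetricSpace E] [CompleteSpace E]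
    {Φ : E → E} {x : E} {r : ℝ} {K : ℝ≥0} (hK : K < 1)
    (hΦ : LipschitzOnWith K Φ (Metric.ball x r)) (hx : dist x (Φ x) < (1 - K) * r) :
    ∃! y, y ∈ Metric.ball x r ∧ Φ y = y := by
  have hK' : (0 : ℝ) < 1 - K := sub_pos.2 (by exact_mod_cast hK)
  set s : ℝ := dist x (Φ x) / (1 - K) with hs
  have hsr : s < r := by rwa [hs, div_lt_iff₀ hK', mul_comm]
  have hxs : dist x (Φ x) = (1 - K) * s := by rw [hs, mul_div_cancel₀ _ hK'.ne']
  have hs0 : 0 ≤ s := div_nonneg dist_nonneg hK'.le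
  have hsub : Metric.closedBall x s ⊆ Metric.ball x r := Metric.closedBall_subset_ball hsr
  have hxball : x ∈ Metric.ball x r := hsub (Metric.mem_closedBall_self hs0)
  have hmaps : Set.MapsTo Φ (Metric.closedBall x s) (Metric.closedBall x s) := fun y hy => by
    have hy' : dist y x ≤ s := hy
    calc dist (Φ y) x ≤ dist (Φ y) (Φ x) + dist (Φ x) x := dist_triangle _ _ _
      _ ≤ K * s + (1 - K) * s := by
          rw [dist_comm (Φ x) x, hxs]
          gcongr
          exact (hΦ.dist_le_mul y (hsub hy) x hxball).trans (by gcongr)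
      _ = s := by ring
  have hcontr : ContractingWith K (hmaps.restrict Φ _ _) :=
    ⟨hK, (hΦ.mono hsub).mapsToRestrict hmaps⟩
  obtain ⟨y, hy, hfix, -⟩ := hcontr.exists_fixedPoint' Metric.isClosed_closedBall.isComplete hmaps
    (Metric.mem_closedBall_self hs0) (edist_ne_top _ _)
  refine ⟨y, ⟨hsub hy, hfix⟩, fun z ⟨hz, hzfix⟩ => dist_le_zero.1 ?_⟩
  have hzy := hΦ.dist_le_mul z hz y (hsub hy)
  rw [hzfix, hfix] at hzy
  nlinarith [dist_nonneg (x := z) (y := y)]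

theorem existsUnique_fixedPoint_mem_ball_of_norm_map_zero_sub {E : Type*}
    [NormedAddCommGroup E] [CompleteSpace E] {Φ : E → E} {s : Set E} {x : E} {r : ℝ} {K : ℝ≥0}
    (hK : K < 1) (hΦ : LipschitzOnWith K Φ s) (h0 : 0 ∈ s) (hs : Metric.ball x r ⊆ s)
    (hx : ‖Φ 0 - x‖ + K * ‖x‖ < (1 - K) * r) :
    ∃! y, y ∈ Metric.ball x r ∧ Φ y = y := by
  have hK' : (0 : ℝ) < 1 - K := sub_pos.2 (by exact_mod_cast hK)
  have hr : 0 < r := pos_of_mul_pos_right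
    ((add_nonneg (norm_nonneg _) (by positivity)).trans_lt hx) hK'.le
  refine existsUnique_fixedPoint_mem_ball hK (hΦ.mono hs) (lt_of_le_of_lt ?_ hx)
  rw [dist_comm, dist_eq_norm]
  calc ‖Φ x - x‖ ≤ ‖Φ x - Φ 0‖ + ‖Φ 0 - x‖ := norm_sub_le_norm_sub_add_norm_sub _ _ _
    _ ≤ K * ‖x‖ + ‖Φ 0 - x‖ := by
        gcongr
        simpa using hΦ.norm_sub_le (hs (Metric.mem_ball_self hr)) h0
    _ = ‖Φ 0 - x‖ + K * ‖x‖ := add_comm _ _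

theorem tendsto_rpow_nhdsGT_zero {γ : ℝ} (hγ : 0 < γ) :
    Tendsto (fun ε : ℝ => ε ^ γ) (𝓝[>] 0) (𝓝[>] 0) := by
  refine tendsto_nhdsWithin_iff.2 ⟨?_, ?_⟩
  · simpa [Real.zero_rpow hγ.ne'] using
      ((Real.continuousAt_rpow_const 0 γ (Or.inr hγ.le)).tendsto.mono_left nhdsWithin_le_nhds)
  · filter_upwards [self_mem_nhdsWithin] with ε hε using Real.rpow_pos_of_pos hε γ

theorem eventually_mul_lt_nhdsGT_zero (a : ℝ) {b : ℝ} (hb : 0 < b) :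
    ∀ᶠ ε in 𝓝[>] (0 : ℝ), a * ε < b := by
  have hlim : Tendsto (fun ε : ℝ => a * ε) (𝓝[>] 0) (𝓝 (a * 0)) :=
    (tendsto_nhdsWithin_of_tendsto_nhds tendsto_id).const_mul a
  rw [mul_zero] at hlim
  exact hlim.eventually_lt_const hb

theorem existsUnique_fixedPoint_mem_ball_rpow {E : Type*} [NormedAddCommGroup E]
    [NormedSpace ℝ E] [CompleteSpace E] {Φ : E → E} {s : Set E} {q : E} {C τ γ ε : ℝ}
    (hC : 0 ≤ C) (hτ1 : τ ≤ 1) (hτγ : τ ≤ γ) (hε : 0 < ε) (hε1 : ε ≤ 1) (hCε : C * ε < 1 / 2)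
    (h0 : 0 ∈ s) (hs : Metric.ball (ε • q) ((2 * (C * (1 + ‖q‖)) + 1) * ε ^ (1 + τ)) ⊆ s)
    (hlip : ∀ p ∈ s, ∀ p' ∈ s, ‖Φ p - Φ p'‖ ≤ C * ε * ‖p - p'‖)
    (hzero : ‖Φ 0 - ε • q‖ ≤ C * ε ^ (1 + γ)) :
    ∃! p, p ∈ Metric.ball (ε • q) ((2 * (C * (1 + ‖q‖)) + 1) * ε ^ (1 + τ)) ∧ Φ p = p := by
  have hετ0 : 0 < ε ^ (1 + τ) := Real.rpow_pos_of_pos hε _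
  have hεγ : ε ^ (1 + γ) ≤ ε ^ (1 + τ) :=
    Real.rpow_le_rpow_of_exponent_ge hε hε1 (by gcongr)
  have hε2 : ε * ε ≤ ε ^ (1 + τ) := by
    rw [← pow_two, ← Real.rpow_two]
    exact Real.rpow_le_rpow_of_exponent_ge hε hε1 (by linarith)
  set K : ℝ≥0 := ⟨C * ε, by positivity⟩
  have hlipOn : LipschitzOnWith K Φ s := LipschitzOnWith.of_dist_le_mul fun p hp p' hp' => by
    rw [dist_eq_norm, dist_eq_norm]
    exact hlip p hp p' hp'
  have hK : K < 1 := show C * ε < 1 from hCε.trans one_half_lt_one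
  refine existsUnique_fixedPoint_mem_ball_of_norm_map_zero_sub hK hlipOn h0 hs ?_
  calc ‖Φ 0 - ε • q‖ + C * ε * ‖ε • q‖ ≤ C * ε ^ (1 + γ) + C * ‖q‖ * (ε * ε) := by
        rw [norm_smul, Real.norm_of_nonneg hε.le]
        linarith
    _ ≤ C * ε ^ (1 + τ) + C * ‖q‖ * ε ^ (1 + τ) := by gcongr
    _ < 1 / 2 * ((2 * (C * (1 + ‖q‖)) + 1) * ε ^ (1 + τ)) := by nlinarith
    _ ≤ (1 - C * ε) * ((2 * (C * (1 + ‖q‖)) + 1) * ε ^ (1 + τ)) := by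
        gcongr
        linarith

theorem exists_radius_existsUnique_fixedPoint {E : Type*} [NormedAddCommGroup E]
    [NormedSpace ℝ E] [CompleteSpace E] {N : ℝ → E → E} {q : E} {c C τ γ : ℝ}
    (hq : ‖q‖ < c) (hC : 0 ≤ C) (hτ : 0 < τ) (hτ1 : τ ≤ 1) (hτγ : τ ≤ γ)
    (hlip : ∀ᶠ ε in 𝓝[>] (0 : ℝ), ∀ p ∈ Metric.closedBall (0 : E) (c * ε),
      ∀ p' ∈ Metric.closedBall (0 : E) (c * ε), ‖N ε p - N ε p'‖ ≤ C * ε * ‖p - p'‖)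
    (hzero : ∀ᶠ ε in 𝓝[>] (0 : ℝ), ‖N ε 0 - ε • q‖ ≤ C * ε ^ (1 + γ)) :
    ∃ r > 0, ∀ᶠ ε in 𝓝[>] (0 : ℝ),
      Metric.ball (ε • q) (r * ε ^ (1 + τ)) ⊆ Metric.closedBall 0 (c * ε) ∧
      ∃! p, p ∈ Metric.ball (ε • q) (r * ε ^ (1 + τ)) ∧ N ε p = p := by
  refine ⟨2 * (C * (1 + ‖q‖)) + 1, by positivity, ?_⟩
  filter_upwards [(tendsto_rpow_nhdsGT_zero hτ).eventually
      (eventually_mul_lt_nhdsGT_zero (2 * (C * (1 + ‖q‖)) + 1) (sub_pos.2 hq)),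
    eventually_mul_lt_nhdsGT_zero C one_half_pos, hlip, hzero,
    Ioo_mem_nhdsGT (zero_lt_one' ℝ)] with ε hsmall hCε hlip hzero ⟨hε, hε1⟩
  have hsub : Metric.ball (ε • q) ((2 * (C * (1 + ‖q‖)) + 1) * ε ^ (1 + τ)) ⊆
      Metric.closedBall 0 (c * ε) := by
    refine Metric.ball_subset_closedBall.trans (Metric.closedBall_subset_closedBall' ?_)
    rw [dist_zero_right, norm_smul, Real.norm_of_nonneg hε.le, Real.rpow_add hε, Real.rpow_one]
    nlinarith
  have h0 : (0 : E) ∈ Metric.closedBall 0 (c * ε) :=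
    Metric.mem_closedBall_self (mul_nonneg ((norm_nonneg q).trans hq.le) hε.le)
  exact ⟨hsub, existsUnique_fixedPoint_mem_ball_rpow hC hτ1 hτγ hε hε1.le hCε h0 hsub hlip hzero⟩

end FixedPoint

section Bordered

theorem norm_le_of_two_mul_norm_sub_le {𝕜 E F : Type*} [NontriviallyNormedField 𝕜]
    [SeminormedAddCommGroup E] [NormedSpace 𝕜 E] [SeminormedAddCommGroup F] [NormedSpace 𝕜 F]
    {B B₀ : E →L[𝕜] F} {K : ℝ} (hK : 0 ≤ K) (hB₀ : ∀ x, ‖x‖ ≤ K * ‖B₀ x‖)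
    (hB : 2 * K * ‖B - B₀‖ ≤ 1) (x : E) : ‖x‖ ≤ 2 * K * ‖B x‖ := by
  have hsub : ‖B₀ x‖ ≤ ‖B x‖ + ‖B - B₀‖ * ‖x‖ := by
    refine (norm_le_norm_add_norm_sub (B x) (B₀ x)).trans ?_
    gcongr
    exact (B - B₀).le_opNorm x
  nlinarith [hB₀ x, mul_le_mul_of_nonneg_right hB (norm_nonneg x),
    mul_le_mul_of_nonneg_left hsub hK]

theorem surjective_of_frequently_injective_imp_surjective {𝕜 E F ι : Type*}
    [NontriviallyNormedField 𝕜] [NormedAddCommGroup E] [NormedSpace 𝕜 E] [CompleteSpace E]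
    [NormedAddCommGroup F] [NormedSpace 𝕜 F] [CompleteSpace F] {l : Filter ι}
    {B : ι → E →L[𝕜] F} {B₀ : E →L[𝕜] F} (hB : Tendsto B l (𝓝 B₀))
    (hinj : Function.Injective B₀) (hclosed : IsClosed (Set.range B₀))
    (hsurj : ∃ᶠ i in l, Function.Injective (B i) → Function.Surjective (B i)) :
    Function.Surjective B₀ := by
  obtain ⟨K, hK⟩ := B₀.antilipschitz_of_injective_of_isClosed_range hinj hclosed
  have hbelow : ∀ x, ‖x‖ ≤ K * ‖B₀ x‖ := hK.le_mul_norm (map_zero B₀)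
  have hnear (a : ℝ) {b : ℝ} (hb : 0 < b) : ∀ᶠ i in l, a * ‖B i - B₀‖ < b := by
    have hlim := (tendsto_iff_norm_sub_tendsto_zero.1 hB).const_mul a
    rw [mul_zero] at hlim
    exact hlim.eventually_lt_const hb
  refine Set.range_eq_univ.1 (Set.eq_univ_of_forall fun y => ?_)
  rw [← hclosed.closure_eq, Metric.mem_closure_iff]
  intro ε hε
  obtain ⟨i, ⟨hi, hi1⟩, hiε⟩ := ((hsurj.and_eventually
    (hnear (2 * K) one_pos)).and_eventually (hnear (2 * K * ‖y‖) hε)).exists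
  have hbelow' := norm_le_of_two_mul_norm_sub_le K.coe_nonneg hbelow hi1.le
  obtain ⟨x, rfl⟩ := hi ((injective_iff_map_eq_zero _).2 fun x hx => by
    simpa [hx] using hbelow' x) y
  refine ⟨B₀ x, Set.mem_range_self x, ?_⟩
  calc dist (B i x) (B₀ x) = ‖(B i - B₀) x‖ := dist_eq_norm _ _
    _ ≤ ‖B i - B₀‖ * ‖x‖ := (B i - B₀).le_opNorm x
    _ ≤ ‖B i - B₀‖ * (2 * K * ‖B i x‖) := by gcongr; exact hbelow' x
    _ < ε := by rwa [mul_comm]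

variable {𝕜 X Y : Type*} [NontriviallyNormedField 𝕜]
  [NormedAddCommGroup X] [NormedSpace 𝕜 X] [NormedAddCommGroup Y] [NormedSpace 𝕜 Y]
  {T : X →L[𝕜] Y} {w : Y} {ℓ : X →L[𝕜] 𝕜} {κ : Y →L[𝕜] 𝕜}

/-- The bordered operator `(σ, u) ↦ (T u - σ w, ℓ u)`: one column and one row are added to `T` to
make up for a one-dimensional kernel and cokernel. -/
def borderedMap (T : X →L[𝕜] Y) (w : Y) (ℓ : X →L[𝕜] 𝕜) : 𝕜 × X →L[𝕜] Y × 𝕜 :=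
  .inl 𝕜 Y 𝕜 ∘L (T ∘L .snd 𝕜 𝕜 X - (ContinuousLinearMap.fst 𝕜 𝕜 X).smulRight w) +
    .inr 𝕜 Y 𝕜 ∘L ℓ ∘L .snd 𝕜 𝕜 X

theorem borderedMap_apply (σ : 𝕜) (u : X) : borderedMap T w ℓ (σ, u) = (T u - σ • w, ℓ u) := by
  simp [borderedMap]

theorem continuous_borderedMap (w : Y) (ℓ : X →L[𝕜] 𝕜) :
    Continuous fun T : X →L[𝕜] Y => borderedMap T w ℓ := by
  unfold borderedMap
  fun_prop

theorem injective_borderedMap (hκT : ∀ u, κ (T u) = 0) (hκw : κ w ≠ 0)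
    (hker : ∀ u, T u = 0 → ℓ u = 0 → u = 0) : Function.Injective (borderedMap T w ℓ) := by
  refine (injective_iff_map_eq_zero _).2 fun ⟨σ, u⟩ h => ?_
  rw [borderedMap_apply, Prod.mk_eq_zero] at h
  have hσ : σ = 0 := by simpa [hκT, hκw] using congrArg κ h.1
  have hu : u = 0 := hker u (by simpa [hσ] using h.1) h.2
  rw [hσ, hu, Prod.mk_zero_zero]

theorem range_borderedMap {e : X} (hκT : ∀ u, κ (T u) = 0) (hκw : κ w ≠ 0) (he : T e = 0)
    (hℓe : ℓ e = 1) :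
    Set.range (borderedMap T w ℓ) =
      (fun q : Y × 𝕜 => q.1 - (κ q.1 / κ w) • w) ⁻¹' Set.range T := by
  ext ⟨h, t⟩
  constructor
  · rintro ⟨⟨σ, u⟩, hq⟩
    rw [borderedMap_apply, Prod.mk_inj] at hq
    refine ⟨u, ?_⟩
    simp [← hq.1, hκT, neg_div, hκw]
  · rintro ⟨u, hu⟩
    refine ⟨(-(κ h / κ w), u + (t - ℓ u) • e), ?_⟩
    simp only at hu
    simp [borderedMap_apply, hu, he, hℓe]

theorem isClosed_range_borderedMap {e : X} (hκT : ∀ u, κ (T u) = 0) (hκw : κ w ≠ 0)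
    (he : T e = 0) (hℓe : ℓ e = 1) (hT : IsClosed (Set.range T)) :
    IsClosed (Set.range (borderedMap T w ℓ)) := by
  rw [range_borderedMap hκT hκw he hℓe]
  exact hT.preimage (by fun_prop)

theorem surjective_borderedMap (hT : Function.Surjective T)
    (hinj : Function.Injective (borderedMap T w ℓ)) : Function.Surjective (borderedMap T w ℓ) := by
  obtain ⟨v, rfl⟩ := hT w
  have hv : ℓ v ≠ 0 := fun hv => by
    have h : ((1 : 𝕜), v) = 0 := (injective_iff_map_eq_zero _).1 hinj _ (by
      simp [borderedMap_apply, hv])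
    exact one_ne_zero (Prod.mk_eq_zero.1 h).1
  rintro ⟨h, t⟩
  obtain ⟨u, rfl⟩ := hT h
  refine ⟨((t - ℓ u) / ℓ v, u + ((t - ℓ u) / ℓ v) • v), ?_⟩
  simp [borderedMap_apply, hv]

theorem exists_borderedSolver [CompleteSpace 𝕜] [CompleteSpace X] [CompleteSpace Y] {ι : Type*}
    {l : Filter ι} {Tι : ι → X →L[𝕜] Y} {e : X}
    (hT : IsClosed (Set.range T)) (hker : ∀ u, T u = 0 → ℓ u = 0 → u = 0) (he : T e = 0)
    (hℓe : ℓ e = 1) (hκT : ∀ u, κ (T u) = 0) (hκw : κ w ≠ 0) (hlim : Tendsto Tι l (𝓝 T))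
    (hsurj : ∃ᶠ i in l, Function.Surjective (Tι i)) :
    ∃ S : Y →L[𝕜] 𝕜 × X, ∀ h q, S h = q ↔ T q.2 - q.1 • w = h ∧ ℓ q.2 = 0 := by
  have hinj := injective_borderedMap hκT hκw hker
  have hbij : Function.Surjective (borderedMap T w ℓ) :=
    surjective_of_frequently_injective_imp_surjective
      (((continuous_borderedMap w ℓ).tendsto T).comp hlim) hinj
      (isClosed_range_borderedMap hκT hκw he hℓe hT)
      (hsurj.mono fun _ hi => surjective_borderedMap hi)
  let Φ := ContinuousLinearEquiv.ofBijective (borderedMap T w ℓ)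
    (LinearMap.ker_eq_bot.2 hinj) (LinearMap.range_eq_top.2 hbij)
  refine ⟨Φ.symm ∘L ContinuousLinearMap.inl 𝕜 Y 𝕜, fun h q => ?_⟩
  have hΦ : Φ q = (T q.2 - q.1 • w, ℓ q.2) := borderedMap_apply q.1 q.2
  rw [← Prod.mk_inj, ← hΦ, eq_comm (a := Φ q)]
  exact Φ.symm_apply_eq

end Bordered

section GraphDomain

variable {𝕜 E F : Type*} [NontriviallyNormedField 𝕜] [NormedAddCommGroup E] [NormedSpace 𝕜 E]
  [NormedAddCommGroup F] [NormedSpace 𝕜 F]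

/-- The domain of an unbounded operator `A` as a normed space of its own, with the graph norm
`‖u‖ + ‖A u‖`. It is a type synonym because `A.domain` already carries the norm of `E`. -/
def GraphDomain (A : E →ₗ.[𝕜] F) : Type _ := A.domain

namespace GraphDomain

variable (A : E →ₗ.[𝕜] F)

instance : AddCommGroup (GraphDomain A) := inferInstanceAs (AddCommGroup A.domain)

instance : Module 𝕜 (GraphDomain A) := inferInstanceAs (Module 𝕜 A.domain)

/-- The identity map from `A.domain` to `GraphDomain A`. -/
def ofDomain : A.domain ≃ₗ[𝕜] GraphDomain A := LinearEquiv.refl 𝕜 A.domain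

/-- The map `u ↦ (u, A u)` onto the graph of `A`. The product carries the `ℓ¹` norm, so that the
induced norm is the graph norm itself and not just an equivalent one. -/
def toGraph : GraphDomain A →ₗ[𝕜] WithLp 1 (E × F) :=
  (WithLp.linearEquiv 1 𝕜 (E × F)).symm ∘ₗ A.domain.subtype.prod A.toFun ∘ₗ (ofDomain A).symm

theorem injective_toGraph : Function.Injective (toGraph A) := fun _ _ h =>
  Subtype.ext (congrArg (fun p : WithLp 1 (E × F) => p.fst) h)

instance : NormedAddCommGroup (GraphDomain A) :=
  NormedAddCommGroup.induced _ _ (toGraph A) (injective_toGraph A)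

instance : NormedSpace 𝕜 (GraphDomain A) := NormedSpace.induced 𝕜 _ _ (toGraph A)

theorem norm_ofDomain (u : A.domain) : ‖ofDomain A u‖ = ‖(u : E)‖ + ‖A u‖ :=
  WithLp.prod_norm_eq_of_L1 _

theorem isometry_toGraph : Isometry (toGraph A) := AddMonoidHomClass.isometry_of_norm _ fun _ => rfl

theorem range_toGraph : Set.range (toGraph A) = WithLp.ofLp ⁻¹' (A.graph : Set (E × F)) := by
  ext p
  rw [Set.mem_preimage, SetLike.mem_coe, LinearPMap.mem_graph_iff]
  constructor
  · rintro ⟨u, rfl⟩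
    exact ⟨u, rfl, rfl⟩
  · rintro ⟨u, h₁, h₂⟩
    exact ⟨ofDomain A u, WithLp.ofLp_injective 1 (Prod.ext h₁ h₂)⟩

variable {A} in
theorem completeSpace [CompleteSpace E] [CompleteSpace F] (hA : A.IsClosed) :
    CompleteSpace (GraphDomain A) := by
  refine (isometry_toGraph A).isUniformInducing.completeSpace ?_
  rw [range_toGraph]
  exact (hA.preimage (WithLp.prod_continuous_ofLp 1 E F)).isComplete

/-- The embedding of `GraphDomain A` into the ambient space. -/
def subtypeL : GraphDomain A →L[𝕜] E where
  toLinearMap := A.domain.subtype ∘ₗ (ofDomain A).symm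
  cont := (WithLp.fstL 1 𝕜 E F).continuous.comp (isometry_toGraph A).continuous

/-- The operator `A`, bounded for the graph norm. -/
def toCLM : GraphDomain A →L[𝕜] F where
  toLinearMap := A.toFun ∘ₗ (ofDomain A).symm
  cont := (WithLp.sndL 1 𝕜 E F).continuous.comp (isometry_toGraph A).continuous

variable {A}

theorem subtypeL_ofDomain (u : A.domain) : subtypeL A (ofDomain A u) = u := rfl

theorem norm_subtypeL_le (u : GraphDomain A) : ‖subtypeL A u‖ ≤ ‖u‖ := by
  obtain ⟨u, rfl⟩ := (ofDomain A).surjective u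
  rw [norm_ofDomain, subtypeL_ofDomain]
  exact le_add_of_nonneg_right (norm_nonneg _)

end GraphDomain

end GraphDomain

section Multiplication

theorem norm_dslope_le_of_forall_norm_le {E : Type*} [NormedAddCommGroup E] [NormedSpace ℂ E]
    {h : ℂ → E} {ω₀ ω : ℂ} {c δ : ℝ} (hd : DifferentiableOn ℂ h (Metric.ball ω₀ δ))
    (hb : ∀ z ∈ Metric.ball ω₀ δ, ‖h z‖ ≤ c) (hω : ω ∈ Metric.ball ω₀ δ) :
    ‖dslope h ω₀ ω‖ ≤ 2 * c / δ := by
  refine Complex.norm_dslope_le_div_of_mapsTo_ball hd (fun z hz => ?_) hω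
  rw [Metric.mem_closedBall, dist_eq_norm, two_mul]
  exact norm_sub_le_of_le (hb z hz)
    (hb ω₀ (Metric.mem_ball_self (Metric.pos_of_mem_ball hω)))

theorem norm_sub_sub_smul_deriv_le {E : Type*} [NormedAddCommGroup E] [NormedSpace ℂ E]
    [CompleteSpace E] {h : ℂ → E} {ω₀ ω : ℂ} {c δ : ℝ}
    (hd : DifferentiableOn ℂ h (Metric.ball ω₀ δ)) (hb : ∀ z ∈ Metric.ball ω₀ δ, ‖h z‖ ≤ c)
    (hω : ω ∈ Metric.ball ω₀ δ) :
    ‖h ω - h ω₀ - (ω - ω₀) • deriv h ω₀‖ ≤ 4 * c / δ ^ 2 * ‖ω - ω₀‖ ^ 2 := by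
  have hdslope : DifferentiableOn ℂ (dslope h ω₀) (Metric.ball ω₀ δ) :=
    (Complex.differentiableOn_dslope (Metric.ball_mem_nhds ω₀ (Metric.pos_of_mem_ball hω))).2 hd
  have htaylor : h ω - h ω₀ - (ω - ω₀) • deriv h ω₀ =
      ((ω - ω₀) ^ 2) • dslope (dslope h ω₀) ω₀ ω := by
    rw [pow_two, mul_smul, sub_smul_dslope, dslope_same, smul_sub, sub_smul_dslope]
  rw [htaylor, norm_smul, norm_pow, mul_comm]
  gcongr
  exact (norm_dslope_le_of_forall_norm_le hdslope
    (fun z hz => norm_dslope_le_of_forall_norm_le hd hb hz) hω).trans_eq (by ring)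

variable {d : ℕ} {W : Rd d → ℂ → ℂ} {ω₀ : ℂ} {δ : ℝ}

theorem norm_mulOp_le {w : Rd d → ℂ} {c : ℝ} (hc : 0 ≤ c)
    (h : ∀ᵐ x : Rd d, ‖w x‖ ≤ c) : ‖mulOp w‖ ≤ c := by
  by_cases hw : MemLp w ∞ (volume : Measure (Rd d))
  · refine ContinuousLinearMap.opNorm_le_bound _ hc fun u => ?_
    refine Lp.norm_le_mul_norm_of_ae_le_mul ?_
    filter_upwards [mulOp_coeFn hw u, h] with x hx hx'
    rw [hx, norm_mul]
    gcongr
  · simpa [mulOp, hw] using hc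

theorem mulOp_sub_sub_smul {w₁ w₂ w₃ : Rd d → ℂ} (z : ℂ)
    (h₁ : MemLp w₁ ∞ (volume : Measure (Rd d))) (h₂ : MemLp w₂ ∞ (volume : Measure (Rd d)))
    (h₃ : MemLp w₃ ∞ (volume : Measure (Rd d))) :
    mulOp w₁ - mulOp w₂ - z • mulOp w₃ = mulOp fun x => w₁ x - w₂ x - z * w₃ x := by
  have h₄ : MemLp (fun x => w₁ x - w₂ x - z * w₃ x) ∞ (volume : Measure (Rd d)) :=
    (h₁.sub h₂).sub (h₃.const_mul z)
  refine ContinuousLinearMap.ext fun u => Lp.ext ?_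
  simp only [sub_apply, smul_apply]
  filter_upwards [mulOp_coeFn h₁ u, mulOp_coeFn h₂ u, mulOp_coeFn h₃ u, mulOp_coeFn h₄ u,
    Lp.coeFn_sub (mulOp w₁ u - mulOp w₂ u) (z • mulOp w₃ u),
    Lp.coeFn_sub (mulOp w₁ u) (mulOp w₂ u), Lp.coeFn_smul z (mulOp w₃ u)]
    with x e₁ e₂ e₃ e₄ e₅ e₆ e₇
  rw [e₅, Pi.sub_apply, e₆, Pi.sub_apply, e₇, Pi.smul_apply, e₁, e₂, e₃, e₄, smul_eq_mul]
  ring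

theorem HypW1.ae_bound (h : HypW1 W ω₀ δ) :
    ∃ c > 0, ∀ᵐ x : Rd d, DifferentiableOn ℂ (W x) (Metric.ball ω₀ δ) ∧
      ∀ ω ∈ Metric.ball ω₀ δ, ‖W x ω‖ ≤ c := by
  obtain ⟨hd, c, hc, hb⟩ := h
  refine ⟨c, hc, ?_⟩
  obtain ⟨s, hs, hsd⟩ := TopologicalSpace.exists_countable_dense ℂ
  have hball : ∀ᵐ x : Rd d, ∀ ω ∈ s, ω ∈ Metric.ball ω₀ δ → ‖W x ω‖ ≤ c := by
    rw [ae_ball_iff hs]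
    intro ω _
    by_cases hω : ω ∈ Metric.ball ω₀ δ
    · have hess := (hb ω hω).2
      rw [eLpNorm_exponent_top] at hess
      filter_upwards [ae_le_eLpNormEssSup (f := fun x => W x ω) (μ := volume)] with x hx _
      rw [← ENNReal.ofReal_le_ofReal_iff hc.le, ofReal_norm]
      exact hx.trans hess
    · exact Filter.Eventually.of_forall fun x h => absurd h hω
  filter_upwards [hd, hball] with x hx hbound
  refine ⟨hx, fun ω hω => ?_⟩
  by_contra! hlt
  have hopen : IsOpen (Metric.ball ω₀ δ ∩ W x ⁻¹' {z | c < ‖z‖}) :=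
    hx.continuousOn.isOpen_inter_preimage Metric.isOpen_ball
      (isOpen_lt continuous_const continuous_norm)
  obtain ⟨ω', ⟨hω', hlt'⟩, hω's⟩ := hsd.inter_open_nonempty _ hopen ⟨ω, hω, hlt⟩
  exact absurd (hbound ω' hω's hω') (not_le.2 hlt')

theorem HypW1.mono (h : HypW1 W ω₀ δ) {ω₁ : ℂ} {δ₁ : ℝ}
    (hsub : Metric.ball ω₁ δ₁ ⊆ Metric.ball ω₀ δ) : HypW1 W ω₁ δ₁ :=
  ⟨h.1.mono fun _ hx => hx.mono hsub, h.2.imp fun _ hc => ⟨hc.1, fun ω hω => hc.2 ω (hsub hω)⟩⟩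

theorem HypW1.memLp {ω : ℂ} (h : HypW1 W ω₀ δ) (hω : ω ∈ Metric.ball ω₀ δ) :
    MemLp (fun x => W x ω) ∞ (volume : Measure (Rd d)) := by
  obtain ⟨-, c, -, hb⟩ := h
  exact ⟨(hb ω hω).1, (hb ω hω).2.trans_lt ENNReal.ofReal_lt_top⟩

theorem HypW1.memLp_dW (hδ : 0 < δ) (h : HypW1 W ω₀ δ) :
    MemLp (dW W ω₀) ∞ (volume : Measure (Rd d)) := by
  obtain ⟨c, -, hae⟩ := h.ae_bound
  have hω₀ : ω₀ ∈ Metric.ball ω₀ δ := Metric.mem_ball_self hδ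
  obtain ⟨s, hs, hsball⟩ := exists_seq_forall_of_frequently
    (eventually_nhdsWithin_of_eventually_nhds (s := {ω₀}ᶜ)
      (Metric.ball_mem_nhds ω₀ hδ)).frequently
  have hmeas : AEStronglyMeasurable (dW W ω₀) (volume : Measure (Rd d)) := by
    refine aestronglyMeasurable_of_tendsto_ae atTop (f := fun n x => slope (W x) ω₀ (s n))
      (fun n => ?_) ?_
    · exact ((h.memLp (hsball n)).1.sub (h.memLp hω₀).1).const_smul (s n - ω₀)⁻¹
    · filter_upwards [hae] with x hx
      exact (hx.1.differentiableAt
        (Metric.isOpen_ball.mem_nhds hω₀)).hasDerivAt.tendsto_slope.comp hs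
  refine memLp_top_of_bound hmeas (2 * c / δ) ?_
  filter_upwards [hae] with x hx
  rw [dW, ← dslope_same]
  exact norm_dslope_le_of_forall_norm_le hx.1 hx.2 hω₀

theorem HypW1.hasDerivAt_mulOp (hδ : 0 < δ) (h : HypW1 W ω₀ δ) :
    HasDerivAt (fun ω => (mulOp fun x => W x ω : L2 d →L[ℂ] L2 d)) (mulOp (dW W ω₀)) ω₀ := by
  obtain ⟨c, hc, hae⟩ := h.ae_bound
  have hω₀ : ω₀ ∈ Metric.ball ω₀ δ := Metric.mem_ball_self hδ
  refine hasDerivAt_iff_isLittleO.2 (Asymptotics.IsBigO.trans_isLittleO ?_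
    (Asymptotics.isLittleO_pow_sub_sub ω₀ one_lt_two))
  refine Asymptotics.IsBigO.of_bound (4 * c / δ ^ 2) ?_
  filter_upwards [Metric.ball_mem_nhds ω₀ hδ] with ω hω
  rw [mulOp_sub_sub_smul _ (h.memLp hω) (h.memLp hω₀) (h.memLp_dW hδ),
    Real.norm_of_nonneg (by positivity)]
  refine norm_mulOp_le (by positivity) ?_
  filter_upwards [hae] with x hx
  exact norm_sub_sub_smul_deriv_le hx.1 hx.2 hω

theorem HypW1.analyticAt_mulOp (hδ : 0 < δ) (h : HypW1 W ω₀ δ) :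
    AnalyticAt ℂ (fun ω => (mulOp fun x => W x ω : L2 d →L[ℂ] L2 d)) ω₀ := by
  refine DifferentiableOn.analyticAt (s := Metric.ball ω₀ δ) (fun ω hω => ?_)
    (Metric.ball_mem_nhds ω₀ hδ)
  obtain ⟨ρ, hρ, hsub⟩ := Metric.isOpen_iff.1 Metric.isOpen_ball ω hω
  exact ((h.mono hsub).hasDerivAt_mulOp hρ).differentiableAt.differentiableWithinAt

end Multiplication

section SecondOrder

theorem exists_norm_sub_le_of_fderiv_eq_zero {𝕜 E F : Type*} [RCLike 𝕜] [NormedAddCommGroup E]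
    [NormedSpace 𝕜 E] [NormedAddCommGroup F] [NormedSpace 𝕜 F] {f : E → F} {x₀ : E}
    (hf : ContDiffAt 𝕜 2 f x₀) (hf₀ : fderiv 𝕜 f x₀ = 0) :
    ∃ C ≥ 0, ∀ᶠ R in 𝓝[>] (0 : ℝ), ∀ x ∈ Metric.closedBall x₀ R, ∀ y ∈ Metric.closedBall x₀ R,
      ‖f x - f y‖ ≤ C * R * ‖x - y‖ := by
  let _ : NormedSpace ℝ E := NormedSpace.restrictScalars ℝ 𝕜 E
  obtain ⟨C, s, hs, hlip⟩ :=
    (hf.fderiv_right (m := 1) (by norm_num)).exists_lipschitzOnWith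
  have hdiff : ∀ᶠ x in 𝓝 x₀, x ∈ s ∧ DifferentiableAt 𝕜 f x :=
    (eventually_mem_set.2 hs).and ((hf.eventually (by simp)).mono fun x hx =>
      hx.differentiableAt (by simp))
  obtain ⟨R₀, hR₀, hball⟩ := Metric.eventually_nhds_iff_ball.1 hdiff
  refine ⟨C, C.coe_nonneg, ?_⟩
  filter_upwards [Ioo_mem_nhdsGT hR₀] with R hR x hx y hy
  have hmem : ∀ z ∈ Metric.closedBall x₀ R, z ∈ Metric.ball x₀ R₀ := fun z hz =>
    Metric.closedBall_subset_ball hR.2 hz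
  refine (convex_closedBall x₀ R).norm_image_sub_le_of_norm_fderiv_le
    (fun z hz => (hball z (hmem z hz)).2) (fun z hz' => ?_) hy hx
  have hz := hlip.norm_sub_le (hball z (hmem z hz')).1 (mem_of_mem_nhds hs)
  rw [hf₀, sub_zero] at hz
  exact hz.trans (by gcongr; exact mem_closedBall_iff_norm.1 hz')

/-- The remainder of `(σ, u) ↦ M (ω₀ + σ) (v + u)` beyond `M ω₀ (v + u) + σ (deriv M ω₀) v`. -/
def secondOrderRemainder {𝕜 Y Z : Type*} [NontriviallyNormedField 𝕜] [NormedAddCommGroup Y]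
    [NormedSpace 𝕜 Y] [NormedAddCommGroup Z] [NormedSpace 𝕜 Z] (M : 𝕜 → Y →L[𝕜] Z) (ω₀ : 𝕜)
    (v : Y) (p : 𝕜 × Y) : Z :=
  (M (ω₀ + p.1) - M ω₀) (v + p.2) - p.1 • deriv M ω₀ v

theorem exists_norm_secondOrderRemainder_sub_le {𝕜 Y Z : Type*} [RCLike 𝕜]
    [NormedAddCommGroup Y] [NormedSpace 𝕜 Y] [NormedAddCommGroup Z] [NormedSpace 𝕜 Z]
    {M : 𝕜 → Y →L[𝕜] Z} {ω₀ : 𝕜} (hM : ContDiffAt 𝕜 2 M ω₀) (v : Y) :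
    ∃ C ≥ 0, ∀ᶠ R in 𝓝[>] (0 : ℝ), ∀ p ∈ Metric.closedBall (0 : 𝕜 × Y) R,
      ∀ p' ∈ Metric.closedBall (0 : 𝕜 × Y) R,
        ‖secondOrderRemainder M ω₀ v p - secondOrderRemainder M ω₀ v p'‖ ≤ C * R * ‖p - p'‖ := by
  have hshift : HasFDerivAt (fun p : 𝕜 × Y => ω₀ + p.1) (ContinuousLinearMap.fst 𝕜 𝕜 Y) 0 :=
    hasFDerivAt_fst.const_add ω₀
  have hshift0 : ω₀ + (0 : 𝕜 × Y).1 = ω₀ := add_zero ω₀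
  rw [← hshift0] at hM
  have hsmooth : ContDiffAt 𝕜 2 (secondOrderRemainder M ω₀ v) 0 := by
    have hMshift : ContDiffAt 𝕜 2 (fun p : 𝕜 × Y => M (ω₀ + p.1)) 0 :=
      hM.comp (0 : 𝕜 × Y) (by fun_prop)
    exact ((hMshift.sub contDiffAt_const).clm_apply (by fun_prop)).sub (by fun_prop)
  have hderiv : HasFDerivAt (secondOrderRemainder M ω₀ v) (0 : 𝕜 × Y →L[𝕜] Z) 0 := by
    have hMshift : HasFDerivAt (fun p : 𝕜 × Y => M (ω₀ + p.1)) _ 0 :=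
      (hM.differentiableAt (by simp)).hasFDerivAt.comp (0 : 𝕜 × Y) hshift
    have hvshift : HasFDerivAt (fun p : 𝕜 × Y => v + p.2) (ContinuousLinearMap.snd 𝕜 𝕜 Y) 0 :=
      hasFDerivAt_snd.const_add v
    refine (((hMshift.sub_const (M ω₀)).clm_apply hvshift).sub
      (hasFDerivAt_fst.smul_const (deriv M ω₀ v))).congr_fderiv ?_
    ext p <;> simp
  exact exists_norm_sub_le_of_fderiv_eq_zero hsmooth hderiv.fderiv

end SecondOrder

section Superposition

variable {d : ℕ} {A : Op d} {W : Rd d → ℂ → ℂ} {f : Rd d → ℂ → ℂ → ℂ} {g : Rd d → ℂ}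
  {ω₀ : ℂ} {φ₀ : A.domain} {δ α β lam₀ : ℝ}

open Classical in
/-- The superposition `f(·, ω, φ(·))` as an element of `L²` (zero if it is not in `L²`). -/
def superpos (f : Rd d → ℂ → ℂ → ℂ) (ω : ℂ) (φ : L2 d) : L2 d :=
  if h : MemLp (fun x => f x ω (φ x)) 2 volume then h.toLp _ else 0

theorem superpos_coeFn {ω : ℂ} {φ : L2 d} (h : MemLp (fun x => f x ω (φ x)) 2 volume) :
    (superpos f ω φ : Rd d → ℂ) =ᵐ[volume] fun x => f x ω (φ x) := by
  rw [superpos, dif_pos h]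
  exact h.coeFn_toLp

theorem superpos_smul_coeFn {ω z : ℂ} {φ : L2 d}
    (h : MemLp (fun x => f x ω ((z • φ : L2 d) x)) 2 volume) :
    (superpos f ω (z • φ) : Rd d → ℂ) =ᵐ[volume] fun x => f x ω (z * φ x) := by
  filter_upwards [superpos_coeFn h, Lp.coeFn_smul z φ] with x h1 h2
  rw [h1, h2, Pi.smul_apply, smul_eq_mul]

theorem solves_iff {ω : ℂ} {φ : A.domain} (h : MemLp (fun x => f x ω ((φ : L2 d) x)) 2 volume) :
    Solves A W f ω φ ↔ linOp A W ω φ = superpos f ω φ := by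
  constructor
  · rintro ⟨_, hsol⟩
    exact Lp.ext (hsol.trans (superpos_coeFn h).symm)
  · intro hsol
    refine ⟨φ.2, ?_⟩
    change (linOp A W ω φ : Rd d → ℂ) =ᵐ[volume] _
    rw [hsol]
    exact superpos_coeFn h

theorem graphNorm_eq_norm_ofDomain (u : A.domain) : graphNorm A u = ‖GraphDomain.ofDomain A u‖ :=
  (GraphDomain.norm_ofDomain A u).symm

theorem HypF1.eventually_memLp (hf1 : HypF1 A f ω₀ δ) (hδ : 0 < δ) (φ₀ : A.domain) :
    ∀ᶠ lam : ℝ in 𝓝[>] 0, ∀ ω ∈ Metric.ball ω₀ δ, ∀ u : A.domain, graphNorm A (u - φ₀) < δ →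
      MemLp (fun x => f x ω (((lam : ℂ) • (u : L2 d) : L2 d) x)) 2 volume := by
  filter_upwards [eventually_mul_lt_nhdsGT_zero (graphNorm A φ₀ + δ) hδ, self_mem_nhdsWithin]
    with lam hsmall hlam ω hω u hu
  replace hlam : 0 < lam := hlam
  refine hf1 ω hω ((lam : ℂ) • u) ?_
  rw [graphNorm_eq_norm_ofDomain] at hu hsmall ⊢
  rw [map_sub] at hu
  rw [map_smul, norm_smul, Complex.norm_real, Real.norm_of_nonneg hlam.le]
  refine lt_of_le_of_lt ?_ hsmall
  rw [mul_comm]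
  gcongr
  exact (norm_le_norm_add_norm_sub' _ _).trans (by gcongr)

theorem norm_sub_le_of_eLpNorm_le {F G : L2 d} {F' G' : Rd d → ℂ} {c : ℝ} (hc : 0 ≤ c)
    (hF : (F : Rd d → ℂ) =ᵐ[volume] F') (hG : (G : Rd d → ℂ) =ᵐ[volume] G')
    (h : eLpNorm (fun x => F' x - G' x) 2 volume ≤ ENNReal.ofReal c) : ‖F - G‖ ≤ c := by
  rw [Lp.norm_def]
  refine ENNReal.toReal_le_of_le_ofReal hc (le_trans (le_of_eq (eLpNorm_congr_ae ?_)) h)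
  filter_upwards [Lp.coeFn_sub F G, hF, hG] with x h1 h2 h3
  rw [h1, Pi.sub_apply, h2, h3]

theorem exists_norm_superpos_sub_le (hδ : 0 < δ) (hlam₀ : 0 < lam₀) (hf1 : HypF1 A f ω₀ δ)
    (hf2 : HypF2 A f ω₀ φ₀ δ α lam₀) (hf3 : HypF3 A f ω₀ φ₀ δ α lam₀) :
    ∃ K ≥ 0, ∀ᶠ lam : ℝ in 𝓝[>] 0,
      ∀ ω₁ ∈ Metric.ball ω₀ δ, ∀ ω₂ ∈ Metric.ball ω₀ δ,
      ∀ u₁ : A.domain, graphNorm A (u₁ - φ₀) < δ → ∀ u₂ : A.domain, graphNorm A (u₂ - φ₀) < δ →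
        ‖superpos f ω₁ ((lam : ℂ) • (u₁ : L2 d)) - superpos f ω₂ ((lam : ℂ) • (u₂ : L2 d))‖ ≤
          lam ^ (1 / α + 1) * (K * (‖ω₁ - ω₂‖ + ‖(u₁ : L2 d) - u₂‖)) := by
  obtain ⟨K₂, hK₂, hf2⟩ := hf2
  obtain ⟨K₃, hK₃, hf3⟩ := hf3
  refine ⟨max K₂ K₃, by positivity, ?_⟩
  filter_upwards [hf1.eventually_memLp hδ φ₀, Ioo_mem_nhdsGT hlam₀]
    with lam hmem hlam ω₁ hω₁ ω₂ hω₂ u₁ hu₁ u₂ hu₂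
  have hlam0 : 0 < lam := hlam.1
  have e₁₁ := superpos_smul_coeFn (hmem ω₁ hω₁ u₁ hu₁)
  have e₂₁ := superpos_smul_coeFn (hmem ω₂ hω₂ u₁ hu₁)
  have e₂₂ := superpos_smul_coeFn (hmem ω₂ hω₂ u₂ hu₂)
  have hω := norm_sub_le_of_eLpNorm_le (by positivity) e₁₁ e₂₁ (hf2 lam hlam ω₁ hω₁ ω₂ hω₂ u₁ hu₁)
  have hu := norm_sub_le_of_eLpNorm_le (by positivity) e₂₁ e₂₂ (hf3 lam hlam u₁ hu₁ u₂ hu₂ ω₂ hω₂)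
  calc _ ≤ K₂ * lam ^ (1 / α + 1) * ‖ω₁ - ω₂‖ + K₃ * lam ^ (1 / α + 1) * ‖(u₁ : L2 d) - u₂‖ :=
        (norm_sub_le_norm_sub_add_norm_sub _ _ _).trans (add_le_add hω hu)
    _ ≤ max K₂ K₃ * lam ^ (1 / α + 1) * ‖ω₁ - ω₂‖ +
          max K₂ K₃ * lam ^ (1 / α + 1) * ‖(u₁ : L2 d) - u₂‖ := by
        gcongr
        exacts [le_max_left _ _, le_max_right _ _]
    _ = _ := by ring

theorem norm_sub_rpow_mul_le {F : ℂ → ℂ} {G z : ℂ} {a b C r m lam : ℝ} (hab : 0 ≤ a + b)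
    (hF : ∀ z, ‖z‖ < r → ‖F z - G * ((‖z‖ ^ a : ℝ) : ℂ) * z‖ ≤ C * ‖z‖ ^ (a + 1 + b))
    (hlam : 0 < lam) (hlamr : lam * m < r) (hz : ‖z‖ ≤ m) :
    ‖F (lam * z) - ((lam ^ (a + 1) : ℝ) : ℂ) * (G * ((‖z‖ ^ a : ℝ) : ℂ) * z)‖ ≤
      |C| * m ^ (a + b) * lam ^ (a + 1 + b) * ‖z‖ := by
  have hnorm : ‖(lam : ℂ) * z‖ = lam * ‖z‖ := by
    rw [norm_mul, Complex.norm_real, Real.norm_of_nonneg hlam.le]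
  have hscale : ((lam ^ (a + 1) : ℝ) : ℂ) * (G * ((‖z‖ ^ a : ℝ) : ℂ) * z) =
      G * ((‖(lam : ℂ) * z‖ ^ a : ℝ) : ℂ) * (lam * z) := by
    rw [hnorm, Real.mul_rpow hlam.le (norm_nonneg z), Real.rpow_add_one hlam.ne']
    push_cast
    ring
  have hpow : ‖z‖ ^ (a + 1 + b) = ‖z‖ ^ (a + b) * ‖z‖ := by
    rw [← Real.rpow_add_one' (norm_nonneg z) (by positivity), add_right_comm]
  rw [hscale]
  calc _ ≤ C * ‖(lam : ℂ) * z‖ ^ (a + 1 + b) := hF _ (hnorm ▸ lt_of_le_of_lt (by gcongr) hlamr)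
    _ = C * (lam ^ (a + 1 + b) * (‖z‖ ^ (a + b) * ‖z‖)) := by
        rw [hnorm, Real.mul_rpow hlam.le (norm_nonneg z), hpow]
    _ ≤ |C| * (lam ^ (a + 1 + b) * (m ^ (a + b) * ‖z‖)) := by
        gcongr
        exact le_abs_self C
    _ = _ := by ring

theorem memLp_mul_norm_rpow {φ : L2 d} (hα : 0 < α) (hg : MemLp g ∞ volume)
    (hφ : MemLp φ ∞ volume) :
    MemLp (fun x => g x * ((‖φ x‖ ^ (1 / α) : ℝ) : ℂ)) ∞ volume := by
  have hpow := hφ.norm_rpow_div (ENNReal.ofReal (1 / α))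
  rw [ENNReal.top_div_of_ne_top ENNReal.ofReal_ne_top,
    ENNReal.toReal_ofReal (by positivity)] at hpow
  exact hpow.ofReal.mul hg

theorem exists_norm_superpos_sub_leading_le (hδ : 0 < δ) (hα : 0 < α) (hβ : 0 < β)
    (hφ₀ : MemLp (φ₀ : L2 d) ∞ volume) (hf1 : HypF1 A f ω₀ δ) (hg : MemLp g ∞ volume)
    (hfg : ∃ C : ℝ, ∃ r > 0, ∀ᵐ x : Rd d, ∀ z : ℂ, ‖z‖ < r →
      ‖f x ω₀ z - g x * ((‖z‖ ^ (1 / α) : ℝ) : ℂ) * z‖ ≤ C * ‖z‖ ^ (1 / α + 1 + β)) :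
    ∃ C : ℝ, ∀ᶠ lam : ℝ in 𝓝[>] 0,
      ‖superpos f ω₀ ((lam : ℂ) • (φ₀ : L2 d)) -
        ((lam ^ (1 / α + 1) : ℝ) : ℂ) • leading g α (φ₀ : L2 d)‖ ≤
        C * lam ^ (1 / α + 1 + β) := by
  obtain ⟨C, r, hr, hO⟩ := hfg
  set m : ℝ := lpNorm (φ₀ : L2 d) ∞ volume
  refine ⟨|C| * m ^ (1 / α + β) * ‖(φ₀ : L2 d)‖, ?_⟩
  filter_upwards [hf1.eventually_memLp hδ φ₀, eventually_mul_lt_nhdsGT_zero m hr,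
    self_mem_nhdsWithin] with lam hmem hlamr hlam
  have hmem₀ := hmem ω₀ (Metric.mem_ball_self hδ) φ₀ (by simpa [graphNorm] using hδ)
  rw [mul_right_comm]
  refine Lp.norm_le_mul_norm_of_ae_le_mul ?_
  filter_upwards [superpos_smul_coeFn hmem₀,
    mulOp_coeFn (memLp_mul_norm_rpow hα hg hφ₀) (φ₀ : L2 d), ae_le_lpNorm_exponent_top hφ₀, hO,
    Lp.coeFn_sub (superpos f ω₀ ((lam : ℂ) • (φ₀ : L2 d)))
      (((lam ^ (1 / α + 1) : ℝ) : ℂ) • leading g α (φ₀ : L2 d)),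
    Lp.coeFn_smul ((lam ^ (1 / α + 1) : ℝ) : ℂ) (leading g α (φ₀ : L2 d))]
    with x hf hlead hx hOx hsub hsmul
  rw [hsub, Pi.sub_apply, hsmul, Pi.smul_apply, hf, leading, hlead, smul_eq_mul]
  exact norm_sub_rpow_mul_le (by positivity) hOx hlam (by rwa [mul_comm]) hx

end Superposition

section LinearizedOperator

variable {d : ℕ} {A : Op d} {W : Rd d → ℂ → ℂ} {ω₀ : ℂ} {φ₀ : A.domain} {φs : L2 d} {δ : ℝ}

/-- The operator `L(·, ω)`, bounded for the graph norm of `A`. -/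
def linOpCLM (A : Op d) (W : Rd d → ℂ → ℂ) (ω : ℂ) : GraphDomain A →L[ℂ] L2 d :=
  GraphDomain.toCLM A - (mulOp fun x => W x ω) ∘L GraphDomain.subtypeL A

theorem linOpCLM_ofDomain (ω : ℂ) (u : A.domain) :
    linOpCLM A W ω (GraphDomain.ofDomain A u) = linOp A W ω u := rfl

theorem linOpCLM_apply_eq (ω ω' : ℂ) (u : GraphDomain A) :
    linOpCLM A W ω u = linOpCLM A W ω' u -
      ((mulOp fun x => W x ω) - mulOp fun x => W x ω') (GraphDomain.subtypeL A u) := by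
  simp [linOpCLM]

theorem HypW1.tendsto_linOpCLM (hδ : 0 < δ) (h : HypW1 W ω₀ δ) :
    Tendsto (linOpCLM A W) (𝓝 ω₀) (𝓝 (linOpCLM A W ω₀)) :=
  (continuousAt_const.sub
    ((h.hasDerivAt_mulOp hδ).continuousAt.clm_comp continuousAt_const)).tendsto

theorem InResolvent.surjective_linOpCLM {ω : ℂ} (h : InResolvent (linOp A W ω) 0) :
    Function.Surjective (linOpCLM A W ω) := by
  obtain ⟨R, hR, -⟩ := h
  intro v
  obtain ⟨hdom, hRv⟩ := hR v
  rw [zero_smul, sub_zero] at hRv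
  exact ⟨GraphDomain.ofDomain A ⟨R v, hdom⟩, hRv⟩

theorem pair_linOp_eq_zero (hdense : Dense (A.domain : Set (L2 d)))
    (hφs : ∃ h : φs ∈ (linOp A W ω₀)†.domain, (linOp A W ω₀)† ⟨φs, h⟩ = 0) (u : A.domain) :
    pair (linOp A W ω₀ u) φs = 0 := by
  obtain ⟨hdom, hzero⟩ := hφs
  have hadj := LinearPMap.adjoint_isFormalAdjoint (T := linOp A W ω₀) hdense ⟨φs, hdom⟩ u
  rw [hzero, inner_zero_left] at hadj
  exact hadj.symm

theorem linOp_eq_zero_iff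
    (hker : {u : L2 d | ∃ h : u ∈ (linOp A W ω₀).domain, linOp A W ω₀ ⟨u, h⟩ = 0} =
      (Submodule.span ℂ {(φ₀ : L2 d)} : Set (L2 d))) (u : A.domain) :
    linOp A W ω₀ u = 0 ↔ ∃ c : ℂ, c • φ₀ = u := by
  have hmem : linOp A W ω₀ u = 0 ↔ (u : L2 d) ∈ (Submodule.span ℂ {(φ₀ : L2 d)} : Set (L2 d)) := by
    rw [← hker]
    exact ⟨fun h => ⟨u.2, h⟩, fun ⟨_, h⟩ => h⟩
  rw [hmem, SetLike.mem_coe, Submodule.mem_span_singleton]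
  exact exists_congr fun c => ⟨fun h => Subtype.ext h, fun h => congrArg Subtype.val h⟩

theorem exists_linearizedSolver (hδ : 0 < δ) (hdense : Dense (A.domain : Set (L2 d)))
    (hclosed : A.IsClosed) (hW1 : HypW1 W ω₀ δ)
    (hker : ∀ u : A.domain, linOp A W ω₀ u = 0 ↔ ∃ c : ℂ, c • φ₀ = u)
    (hres : ∃ᶠ ω in 𝓝 ω₀, InResolvent (linOp A W ω) 0)
    (hrange : IsClosed (Set.range (linOp A W ω₀)))
    (hφs : ∃ h : φs ∈ (linOp A W ω₀)†.domain, (linOp A W ω₀)† ⟨φs, h⟩ = 0)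
    (hnorm : pair (φ₀ : L2 d) φs = 1) (hWt : pair (mulOp (dW W ω₀) (φ₀ : L2 d)) φs ≠ 0) :
    ∃ S : L2 d →L[ℂ] ℂ × GraphDomain A, ∀ h q, S h = q ↔
      linOpCLM A W ω₀ q.2 - q.1 • mulOp (dW W ω₀) (φ₀ : L2 d) = h ∧
        pair (GraphDomain.subtypeL A q.2) φs = 0 := by
  have : CompleteSpace (GraphDomain A) := GraphDomain.completeSpace hclosed
  refine exists_borderedSolver (κ := innerSL ℂ φs)
    (ℓ := innerSL ℂ φs ∘L GraphDomain.subtypeL A) (e := GraphDomain.ofDomain A φ₀)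
    hrange (fun u hu hℓu => ?_) ((hker φ₀).2 ⟨1, one_smul ℂ φ₀⟩) hnorm
    (pair_linOp_eq_zero hdense hφs) hWt (hW1.tendsto_linOpCLM hδ)
    (hres.mono fun _ h => h.surjective_linOpCLM)
  obtain ⟨c, rfl⟩ := (hker u).1 hu
  have hc : c * pair (φ₀ : L2 d) φs = 0 := by
    rw [← hℓu]
    exact (inner_smul_right φs (φ₀ : L2 d) c).symm
  rw [hnorm, mul_one] at hc
  rw [hc, zero_smul]
  rfl

theorem eq_nu_of_linearized {g : ℂ → Rd d → ℂ} {α : ℝ} {ν : ℂ} {u : GraphDomain A}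
    (hκ : ∀ u : A.domain, pair (linOp A W ω₀ u) φs = 0)
    (hWt : pair (mulOp (dW W ω₀) (φ₀ : L2 d)) φs ≠ 0)
    (h : linOpCLM A W ω₀ u - ν • mulOp (dW W ω₀) (φ₀ : L2 d) = leading (g ω₀) α φ₀) :
    ν = nu W g α ω₀ φ₀ φs := by
  have hpair : pair (leading (g ω₀) α (φ₀ : L2 d)) φs =
      -(ν * pair (mulOp (dW W ω₀) (φ₀ : L2 d)) φs) := by
    rw [← h, pair, inner_sub_right, inner_smul_right]
    exact (congrArg (· - _) (hκ u)).trans (zero_sub _)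
  rw [nu, hpair, neg_neg, mul_div_cancel_right₀ _ hWt]

theorem solver_leading_eq_iff {g : ℂ → Rd d → ℂ} {α : ℝ} {S : L2 d →L[ℂ] ℂ × GraphDomain A}
    (hS : ∀ h q, S h = q ↔
      linOpCLM A W ω₀ q.2 - q.1 • mulOp (dW W ω₀) (φ₀ : L2 d) = h ∧
        pair (GraphDomain.subtypeL A q.2) φs = 0) (η : A.domain) (ν : ℂ) :
    S (leading (g ω₀) α φ₀) = (ν, GraphDomain.ofDomain A η) ↔
      pair (η : L2 d) φs = 0 ∧
        linOp A W ω₀ η = leading (g ω₀) α φ₀ + ν • mulOp (dW W ω₀) (φ₀ : L2 d) := by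
  rw [hS, and_comm, sub_eq_iff_eq_add, linOpCLM_ofDomain, GraphDomain.subtypeL_ofDomain]

theorem Isolated.frequently_inResolvent (h : Isolated A W ω₀) :
    ∃ᶠ ω in 𝓝 ω₀, InResolvent (linOp A W ω) 0 := by
  obtain ⟨ρ, hρ, h⟩ := h
  have hne : ∃ᶠ ω in 𝓝 ω₀, ω ≠ ω₀ :=
    (eventually_mem_nhdsWithin (a := ω₀) (s := {ω₀}ᶜ)).frequently.filter_mono nhdsWithin_le_nhds
  refine (hne.and_eventually (Metric.ball_mem_nhds ω₀ hρ)).mono fun ω hω => ?_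
  exact not_not.1 fun hspec => hω.1 ((h ω hω.2).1 hspec)

theorem HypA2.memLp_top (h : HypA2 A) (u : A.domain) : MemLp (u : L2 d) ∞ volume := by
  obtain ⟨C, hC⟩ := h
  exact ⟨Lp.aestronglyMeasurable _, (hC u).trans_lt ENNReal.ofReal_lt_top⟩

end LinearizedOperator

section Reduction

variable {d : ℕ} {A : Op d} {W : Rd d → ℂ → ℂ} {f : Rd d → ℂ → ℂ → ℂ} {g : Rd d → ℂ}
  {ω₀ : ℂ} {φ₀ : A.domain} {φs : L2 d} {δ α β lam₀ : ℝ}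

/-- The right-hand side of the equation for `p = (ω - ω₀, λ⁻¹ φ - φ₀)` that arises from
`L(·, ω) φ = f(·, ω, φ)` when the linearization of `L(·, ω) u` at `(ω₀, φ₀)` is kept on the left:
the rescaled nonlinearity and the terms of `W(·, ω) u` that are quadratic in `p`. -/
def reducedRhs (W : Rd d → ℂ → ℂ) (f : Rd d → ℂ → ℂ → ℂ) (ω₀ : ℂ) (φ₀ : A.domain) (lam : ℝ)
    (p : ℂ × GraphDomain A) : L2 d :=
  (lam : ℂ)⁻¹ • superpos f (ω₀ + p.1) ((lam : ℂ) • ((φ₀ : L2 d) + GraphDomain.subtypeL A p.2)) +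
    secondOrderRemainder (fun ω => mulOp fun x => W x ω) ω₀ (φ₀ : L2 d)
      (p.1, GraphDomain.subtypeL A p.2)

theorem solves_iff_reducedRhs (hδ : 0 < δ) (hW1 : HypW1 W ω₀ δ) (hφ₀ : linOp A W ω₀ φ₀ = 0)
    {lam : ℝ} (hlam : lam ≠ 0) {σ : ℂ} {u : A.domain}
    (hmem : MemLp (fun x => f x (ω₀ + σ) (((lam : ℂ) • ((φ₀ + u : A.domain) : L2 d) : L2 d) x)) 2
      volume) :
    Solves A W f (ω₀ + σ) ((lam : ℂ) • ((φ₀ : L2 d) + u)) ↔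
      linOpCLM A W ω₀ (GraphDomain.ofDomain A u) - σ • mulOp (dW W ω₀) (φ₀ : L2 d) =
        reducedRhs W f ω₀ φ₀ lam (σ, GraphDomain.ofDomain A u) := by
  have hlamℂ : (lam : ℂ) ≠ 0 := Complex.ofReal_ne_zero.2 hlam
  have hexp : linOp A W (ω₀ + σ) (φ₀ + u) =
      linOpCLM A W ω₀ (GraphDomain.ofDomain A u) - σ • mulOp (dW W ω₀) (φ₀ : L2 d) -
        secondOrderRemainder (fun ω => mulOp fun x => W x ω) ω₀ (φ₀ : L2 d) (σ, (u : L2 d)) := by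
    rw [← linOpCLM_ofDomain, linOpCLM_apply_eq _ ω₀, map_add, map_add, linOpCLM_ofDomain, hφ₀,
      zero_add, secondOrderRemainder, (hW1.hasDerivAt_mulOp hδ).deriv, map_add,
      GraphDomain.subtypeL_ofDomain, GraphDomain.subtypeL_ofDomain]
    abel
  have hscale : linOp A W (ω₀ + σ) ((lam : ℂ) • (φ₀ + u)) =
      (lam : ℂ) • linOp A W (ω₀ + σ) (φ₀ + u) := (linOp A W (ω₀ + σ)).map_smul _ _
  rw [reducedRhs, ← sub_eq_iff_eq_add, GraphDomain.subtypeL_ofDomain, ← hexp,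
    eq_inv_smul_iff₀ hlamℂ, ← hscale]
  exact solves_iff (φ := (lam : ℂ) • (φ₀ + u)) hmem

theorem rpow_rpow_one_div_add {ε : ℝ} (hα : 0 < α) (hε : 0 < ε) (η : ℝ) :
    (ε ^ α) ^ (1 / α + 1 + η) = ε ^ α * ε ^ (1 + α * η) := by
  rw [← Real.rpow_mul hε.le, ← Real.rpow_add hε]
  congr 1
  field_simp
  ring

theorem norm_prodMk_subtypeL_le (p : ℂ × GraphDomain A) :
    ‖(p.1, GraphDomain.subtypeL A p.2)‖ ≤ ‖p‖ :=
  max_le_max le_rfl (GraphDomain.norm_subtypeL_le p.2)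

theorem exists_norm_secondOrderRemainder_mulOp_sub_le (hδ : 0 < δ) (hW1 : HypW1 W ω₀ δ) {c : ℝ}
    (hc : 0 < c) (v : L2 d) :
    ∃ C ≥ 0, ∀ᶠ ε in 𝓝[>] (0 : ℝ), ∀ p ∈ Metric.closedBall (0 : ℂ × GraphDomain A) (c * ε),
      ∀ p' ∈ Metric.closedBall (0 : ℂ × GraphDomain A) (c * ε),
        ‖secondOrderRemainder (fun ω => mulOp fun x => W x ω) ω₀ v
              (p.1, GraphDomain.subtypeL A p.2) -
            secondOrderRemainder (fun ω => mulOp fun x => W x ω) ω₀ v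
              (p'.1, GraphDomain.subtypeL A p'.2)‖ ≤ C * ε * ‖p - p'‖ := by
  obtain ⟨C, hC, hev⟩ :=
    exists_norm_secondOrderRemainder_sub_le (hW1.analyticAt_mulOp hδ).contDiffAt v
  have hscale : Tendsto (fun ε => c * ε) (𝓝[>] (0 : ℝ)) (𝓝[>] 0) :=
    tendsto_nhdsWithin_iff.2 ⟨tendsto_nhdsWithin_of_tendsto_nhds
      (Continuous.tendsto' (by fun_prop) _ _ (mul_zero c)),
      eventually_mem_nhdsWithin.mono fun ε hε => mul_pos hc hε⟩
  refine ⟨C * c, by positivity, ?_⟩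
  filter_upwards [hscale.eventually hev, self_mem_nhdsWithin] with ε hε hε0 p hp p' hp'
  have hmem : ∀ p ∈ Metric.closedBall (0 : ℂ × GraphDomain A) (c * ε),
      (p.1, GraphDomain.subtypeL A p.2) ∈ Metric.closedBall 0 (c * ε) := fun p hp =>
    mem_closedBall_zero_iff.2 ((norm_prodMk_subtypeL_le p).trans (mem_closedBall_zero_iff.1 hp))
  have hε0' : 0 < ε := hε0
  have hsub := norm_prodMk_subtypeL_le (p - p')
  rw [Prod.snd_sub, map_sub] at hsub
  calc _ ≤ C * (c * ε) * ‖(p.1, GraphDomain.subtypeL A p.2) -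
          (p'.1, GraphDomain.subtypeL A p'.2)‖ := hε _ (hmem p hp) _ (hmem p' hp')
    _ ≤ C * (c * ε) * ‖p - p'‖ := by gcongr; exact hsub
    _ = _ := by ring

theorem mem_ball_and_graphNorm_lt {σ : ℂ} {u : A.domain}
    (h : ‖(σ, GraphDomain.ofDomain A u)‖ < δ) :
    ω₀ + σ ∈ Metric.ball ω₀ δ ∧ graphNorm A (φ₀ + u - φ₀) < δ := by
  rwa [mem_ball_iff_norm, add_sub_cancel_left, add_sub_cancel_left, graphNorm_eq_norm_ofDomain,
    ← max_lt_iff]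

theorem exists_norm_smul_superpos_sub_le (hδ : 0 < δ) (hα : 0 < α) (hlam₀ : 0 < lam₀)
    (hf1 : HypF1 A f ω₀ δ) (hf2 : HypF2 A f ω₀ φ₀ δ α lam₀) (hf3 : HypF3 A f ω₀ φ₀ δ α lam₀)
    (c : ℝ) :
    ∃ C ≥ 0, ∀ᶠ ε in 𝓝[>] (0 : ℝ), ∀ p ∈ Metric.closedBall (0 : ℂ × GraphDomain A) (c * ε),
      ∀ p' ∈ Metric.closedBall (0 : ℂ × GraphDomain A) (c * ε),
        ‖((ε ^ α : ℝ) : ℂ)⁻¹ • superpos f (ω₀ + p.1)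
              (((ε ^ α : ℝ) : ℂ) • ((φ₀ : L2 d) + GraphDomain.subtypeL A p.2)) -
            ((ε ^ α : ℝ) : ℂ)⁻¹ • superpos f (ω₀ + p'.1)
              (((ε ^ α : ℝ) : ℂ) • ((φ₀ : L2 d) + GraphDomain.subtypeL A p'.2))‖ ≤
          C * ε * ‖p - p'‖ := by
  obtain ⟨K, hK, hev⟩ := exists_norm_superpos_sub_le hδ hlam₀ hf1 hf2 hf3
  refine ⟨K * 2, by positivity, ?_⟩
  filter_upwards [(tendsto_rpow_nhdsGT_zero hα).eventually hev,
    eventually_mul_lt_nhdsGT_zero c hδ, self_mem_nhdsWithin] with ε hlip hcε hε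
  replace hε : 0 < ε := hε
  rintro ⟨σ, u⟩ hp ⟨σ', u'⟩ hp'
  obtain ⟨u, rfl⟩ := (GraphDomain.ofDomain A).surjective u
  obtain ⟨u', rfl⟩ := (GraphDomain.ofDomain A).surjective u'
  set p := (σ, GraphDomain.ofDomain A u)
  set p' := (σ', GraphDomain.ofDomain A u')
  have hmem (q : ℂ × GraphDomain A) (hq : q ∈ Metric.closedBall 0 (c * ε)) : ‖q‖ < δ :=
    (mem_closedBall_zero_iff.1 hq).trans_lt hcε
  obtain ⟨hωσ, hφu⟩ := mem_ball_and_graphNorm_lt (ω₀ := ω₀) (φ₀ := φ₀) (hmem p hp)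
  obtain ⟨hωσ', hφu'⟩ := mem_ball_and_graphNorm_lt (ω₀ := ω₀) (φ₀ := φ₀) (hmem p' hp')
  have hbound := hlip _ hωσ _ hωσ' _ hφu _ hφu'
  have hpow := rpow_rpow_one_div_add hα hε 0
  rw [mul_zero, add_zero, add_zero, Real.rpow_one] at hpow
  rw [hpow, mul_assoc] at hbound
  rw [← smul_sub, norm_smul, norm_inv, Complex.norm_real, Real.norm_of_nonneg (by positivity),
    inv_mul_le_iff₀ (by positivity)]
  have hσ : ‖ω₀ + σ - (ω₀ + σ')‖ ≤ ‖p - p'‖ := by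
    rw [add_sub_add_left_eq_sub]
    exact norm_fst_le (p - p')
  have hu : ‖((φ₀ + u : A.domain) : L2 d) - (φ₀ + u' : A.domain)‖ ≤ ‖p - p'‖ := by
    rw [← Submodule.coe_sub, add_sub_add_left_eq_sub]
    exact (GraphDomain.norm_subtypeL_le _).trans (norm_snd_le (p - p'))
  calc _ ≤ ε ^ α * (ε * (K * (‖ω₀ + σ - (ω₀ + σ')‖ +
          ‖((φ₀ + u : A.domain) : L2 d) - (φ₀ + u' : A.domain)‖))) := hbound
    _ ≤ ε ^ α * (ε * (K * (‖p - p'‖ + ‖p - p'‖))) := by gcongr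
    _ = _ := by ring

theorem exists_norm_reducedRhs_sub_le (hδ : 0 < δ) (hα : 0 < α) (hlam₀ : 0 < lam₀)
    (hW1 : HypW1 W ω₀ δ) (hf1 : HypF1 A f ω₀ δ) (hf2 : HypF2 A f ω₀ φ₀ δ α lam₀)
    (hf3 : HypF3 A f ω₀ φ₀ δ α lam₀) {c : ℝ} (hc : 0 < c) :
    ∃ C ≥ 0, ∀ᶠ ε in 𝓝[>] (0 : ℝ), ∀ p ∈ Metric.closedBall (0 : ℂ × GraphDomain A) (c * ε),
      ∀ p' ∈ Metric.closedBall (0 : ℂ × GraphDomain A) (c * ε),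
        ‖reducedRhs W f ω₀ φ₀ (ε ^ α) p - reducedRhs W f ω₀ φ₀ (ε ^ α) p'‖ ≤
          C * ε * ‖p - p'‖ := by
  obtain ⟨K, hK, hK_ev⟩ := exists_norm_smul_superpos_sub_le hδ hα hlam₀ hf1 hf2 hf3 c
  obtain ⟨C, hC, hC_ev⟩ :=
    exists_norm_secondOrderRemainder_mulOp_sub_le (A := A) hδ hW1 hc (φ₀ : L2 d)
  refine ⟨K + C, by positivity, ?_⟩
  filter_upwards [hK_ev, hC_ev] with ε hKε hCε p hp p' hp'
  rw [reducedRhs, reducedRhs, add_sub_add_comm, add_mul, add_mul]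
  exact norm_add_le_of_le (hKε p hp p' hp') (hCε p hp p' hp')

theorem exists_norm_reducedRhs_zero_sub_le (hδ : 0 < δ) (hα : 0 < α) (hβ : 0 < β)
    (hφ₀ : MemLp (φ₀ : L2 d) ∞ volume) (hf1 : HypF1 A f ω₀ δ) (hg : MemLp g ∞ volume)
    (hfg : ∃ C : ℝ, ∃ r > 0, ∀ᵐ x : Rd d, ∀ z : ℂ, ‖z‖ < r →
      ‖f x ω₀ z - g x * ((‖z‖ ^ (1 / α) : ℝ) : ℂ) * z‖ ≤ C * ‖z‖ ^ (1 / α + 1 + β)) :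
    ∃ C : ℝ, ∀ᶠ ε in 𝓝[>] (0 : ℝ),
      ‖reducedRhs W f ω₀ φ₀ (ε ^ α) 0 - (ε : ℂ) • leading g α (φ₀ : L2 d)‖ ≤
        C * ε ^ (1 + α * β) := by
  obtain ⟨C, hev⟩ := exists_norm_superpos_sub_leading_le hδ hα hβ hφ₀ hf1 hg hfg
  refine ⟨C, ?_⟩
  filter_upwards [(tendsto_rpow_nhdsGT_zero hα).eventually hev, self_mem_nhdsWithin] with ε h hε
  replace hε : 0 < ε := hε
  have hlam : 0 < ε ^ α := Real.rpow_pos_of_pos hε α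
  have hlamℂ : ((ε ^ α : ℝ) : ℂ) ≠ 0 := Complex.ofReal_ne_zero.2 hlam.ne'
  have hpow := rpow_rpow_one_div_add hα hε 0
  rw [mul_zero, add_zero, add_zero, Real.rpow_one] at hpow
  have hfactor : reducedRhs W f ω₀ φ₀ (ε ^ α) 0 - (ε : ℂ) • leading g α (φ₀ : L2 d) =
      ((ε ^ α : ℝ) : ℂ)⁻¹ • (superpos f ω₀ (((ε ^ α : ℝ) : ℂ) • (φ₀ : L2 d)) -
        (((ε ^ α) ^ (1 / α + 1) : ℝ) : ℂ) • leading g α (φ₀ : L2 d)) := by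
    rw [hpow, Complex.ofReal_mul, smul_sub, mul_smul, inv_smul_smul₀ hlamℂ]
    simp [reducedRhs, secondOrderRemainder]
  rw [hfactor, norm_smul, norm_inv, Complex.norm_real, Real.norm_of_nonneg hlam.le,
    inv_mul_le_iff₀ hlam]
  refine h.trans (le_of_eq ?_)
  rw [rpow_rpow_one_div_add hα hε]
  ring

end Reduction

section Reconstruction

variable {d : ℕ} {A : Op d} {W : Rd d → ℂ → ℂ} {f : Rd d → ℂ → ℂ → ℂ}
  {ω₀ : ℂ} {φ₀ ϕ : A.domain} {φs : L2 d} {δ α τ : ℝ}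

/-- The pair `(ω, φ)` described by the rescaled unknown `p`, that is `ω = ω₀ + p.1` and
`φ = λ (φ₀ + p.2)`. -/
def unscale (ω₀ : ℂ) (φ₀ : A.domain) (lam : ℝ) (p : ℂ × GraphDomain A) : ℂ × L2 d :=
  (ω₀ + p.1, (lam : ℂ) • ((φ₀ : L2 d) + GraphDomain.subtypeL A p.2))

theorem mem_ball_mul_iff {E : Type*} [SeminormedAddCommGroup E] [NormedSpace ℝ E] {s : ℝ}
    (hs : 0 < s) (x y : E) (r : ℝ) : y ∈ Metric.ball x (r * s) ↔ ∃ z, ‖z‖ < r ∧ x + s • z = y := by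
  constructor
  · intro hy
    refine ⟨s⁻¹ • (y - x), ?_, by rw [smul_inv_smul₀ hs.ne', add_sub_cancel]⟩
    rw [norm_smul, norm_inv, Real.norm_of_nonneg hs.le, inv_mul_lt_iff₀ hs, mul_comm]
    exact mem_ball_iff_norm.1 hy
  · rintro ⟨z, hz, rfl⟩
    rw [mem_ball_iff_norm, add_sub_cancel_left, norm_smul, Real.norm_of_nonneg hs.le, mul_comm]
    gcongr

theorem unscale_add_smul {ε : ℝ} (hε : 0 < ε) (ν σ : ℂ) (ψ : A.domain) :
    unscale ω₀ φ₀ (ε ^ α) (ε • (ν, GraphDomain.ofDomain A ϕ) +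
        ε ^ (1 + τ) • (σ, GraphDomain.ofDomain A ψ)) =
      (ω₀ + (ε : ℂ) * ν + ((ε ^ (1 + τ) : ℝ) : ℂ) * σ,
        ((ε ^ α : ℝ) : ℂ) • (φ₀ : L2 d) + ((ε ^ (α + 1) : ℝ) : ℂ) • (ϕ : L2 d) +
          ((ε ^ (α + 1 + τ) : ℝ) : ℂ) • (ψ : L2 d)) := by
  rw [add_assoc α 1 τ, Real.rpow_add hε α (1 + τ), Real.rpow_add_one hε.ne']
  simp only [unscale, ← Complex.coe_smul, Prod.smul_mk, Prod.mk_add_mk, map_add, map_smul,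
    GraphDomain.subtypeL_ofDomain, smul_eq_mul, smul_add, smul_smul, Complex.ofReal_mul, add_assoc]

theorem eventually_memLp_unscale (hδ : 0 < δ) (hα : 0 < α) (hf1 : HypF1 A f ω₀ δ) (c : ℝ) :
    ∀ᶠ ε in 𝓝[>] (0 : ℝ), ∀ p ∈ Metric.closedBall (0 : ℂ × GraphDomain A) (c * ε),
      MemLp (fun x => f x (unscale ω₀ φ₀ (ε ^ α) p).1 ((unscale ω₀ φ₀ (ε ^ α) p).2 x)) 2
        volume := by
  filter_upwards [(tendsto_rpow_nhdsGT_zero hα).eventually (hf1.eventually_memLp hδ φ₀),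
    eventually_mul_lt_nhdsGT_zero c hδ] with ε hmem hcε p hp
  obtain ⟨hω, hφ⟩ := mem_ball_and_graphNorm_lt (u := (GraphDomain.ofDomain A).symm p.2)
    ((mem_closedBall_zero_iff.1 hp).trans_lt hcε)
  exact hmem _ hω _ hφ

theorem pair_smul_add (z : ℂ) (u v : L2 d) :
    pair (z • (u + v)) φs = z * (pair u φs + pair v φs) := by
  simp only [pair, inner_smul_right, inner_add_right]

theorem hasExpansion_iff {ε r : ℝ} {ν : ℂ} (hε : 0 < ε) (hϕ : pair (ϕ : L2 d) φs = 0)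
    (y : ℂ × L2 d) :
    HasExpansion A ω₀ ν φ₀ φs ϕ α τ r r ε y.1 y.2 ↔
      ∃ p ∈ Metric.ball (ε • (ν, GraphDomain.ofDomain A ϕ)) (r * ε ^ (1 + τ)),
        pair (GraphDomain.subtypeL A p.2) φs = 0 ∧ unscale ω₀ φ₀ (ε ^ α) p = y := by
  have hs : 0 < ε ^ (1 + τ) := by positivity
  have hpair (σ : ℂ) (ψ : A.domain) : pair (GraphDomain.subtypeL A
      (ε • (ν, GraphDomain.ofDomain A ϕ) + ε ^ (1 + τ) • (σ, GraphDomain.ofDomain A ψ)).2) φs = 0 ↔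
        pair (ψ : L2 d) φs = 0 := by
    simp only [Prod.smul_mk, Prod.mk_add_mk, ← Complex.coe_smul, map_add, map_smul,
      GraphDomain.subtypeL_ofDomain, pair, inner_add_right, inner_smul_right]
    rw [show inner ℂ φs (ϕ : L2 d) = 0 from hϕ, mul_zero, zero_add, mul_eq_zero_iff_left
      (Complex.ofReal_ne_zero.2 hs.ne')]
  constructor
  · rintro ⟨σ, ψ, hσ, hψ, hψφs, hω, hφ⟩
    rw [graphNorm_eq_norm_ofDomain] at hψ
    exact ⟨_, (mem_ball_mul_iff hs _ _ _).2 ⟨(σ, GraphDomain.ofDomain A ψ), max_lt hσ hψ, rfl⟩,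
      (hpair σ ψ).2 hψφs, (unscale_add_smul hε ν σ ψ).trans (Prod.ext hω hφ).symm⟩
  · rintro ⟨p, hp, hpφs, rfl⟩
    obtain ⟨⟨σ, ψ⟩, hσψ, rfl⟩ := (mem_ball_mul_iff hs _ _ _).1 hp
    obtain ⟨ψ, rfl⟩ := (GraphDomain.ofDomain A).surjective ψ
    obtain ⟨hσ, hψ⟩ := max_lt_iff.1 hσψ
    rw [← graphNorm_eq_norm_ofDomain] at hψ
    rw [unscale_add_smul hε]
    exact ⟨σ, ψ, hσ, hψ, (hpair σ ψ).1 hpφs, rfl, rfl⟩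

theorem isSolution_iff_exists_fixedPoint (hδ : 0 < δ) (hW1 : HypW1 W ω₀ δ)
    (hφ₀ : linOp A W ω₀ φ₀ = 0) (hnorm : pair (φ₀ : L2 d) φs = 1)
    {S : L2 d →L[ℂ] ℂ × GraphDomain A}
    (hS : ∀ h q, S h = q ↔
      linOpCLM A W ω₀ q.2 - q.1 • mulOp (dW W ω₀) (φ₀ : L2 d) = h ∧
        pair (GraphDomain.subtypeL A q.2) φs = 0)
    {ε r : ℝ} {ν : ℂ} (hε : 0 < ε) (hϕ : pair (ϕ : L2 d) φs = 0)
    (hmem : ∀ p ∈ Metric.ball (ε • (ν, GraphDomain.ofDomain A ϕ)) (r * ε ^ (1 + τ)),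
      MemLp (fun x => f x (unscale ω₀ φ₀ (ε ^ α) p).1 ((unscale ω₀ φ₀ (ε ^ α) p).2 x)) 2 volume)
    (y : ℂ × L2 d) :
    Solves A W f y.1 y.2 ∧ pair y.2 φs = ((ε ^ α : ℝ) : ℂ) ∧
        HasExpansion A ω₀ ν φ₀ φs ϕ α τ r r ε y.1 y.2 ↔
      ∃ p, (p ∈ Metric.ball (ε • (ν, GraphDomain.ofDomain A ϕ)) (r * ε ^ (1 + τ)) ∧
        S (reducedRhs W f ω₀ φ₀ (ε ^ α) p) = p) ∧ unscale ω₀ φ₀ (ε ^ α) p = y := by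
  have hlam : ε ^ α ≠ 0 := (Real.rpow_pos_of_pos hε α).ne'
  have hsolves (p) (hp : p ∈ Metric.ball (ε • (ν, GraphDomain.ofDomain A ϕ)) (r * ε ^ (1 + τ))) :=
    solves_iff_reducedRhs (u := (GraphDomain.ofDomain A).symm p.2) hδ hW1 hφ₀ hlam (hmem p hp)
  rw [hasExpansion_iff hε hϕ]
  constructor
  · rintro ⟨hsol, -, p, hp, hpφs, rfl⟩
    exact ⟨p, ⟨hp, (hS _ _).2 ⟨(hsolves p hp).1 hsol, hpφs⟩⟩, rfl⟩
  · rintro ⟨p, ⟨hp, hfix⟩, rfl⟩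
    obtain ⟨heq, hpφs⟩ := (hS _ _).1 hfix
    refine ⟨(hsolves p hp).2 heq, ?_, p, hp, hpφs, rfl⟩
    rw [unscale, pair_smul_add, hnorm, hpφs, add_zero, mul_one]

end Reconstruction

section Main

variable {d : ℕ} {A : Op d} {W : Rd d → ℂ → ℂ} {f : Rd d → ℂ → ℂ → ℂ} {g : Rd d → ℂ}
  {ω₀ : ℂ} {φ₀ : A.domain} {δ α β lam₀ τ : ℝ}

theorem exists_radius_existsUnique_reduced (hδ : 0 < δ) (hα : 0 < α) (hβ : 0 < β)
    (hlam₀ : 0 < lam₀) (hclosed : A.IsClosed) (hφ₀ : MemLp (φ₀ : L2 d) ∞ volume)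
    (hW1 : HypW1 W ω₀ δ) (hf1 : HypF1 A f ω₀ δ) (hf2 : HypF2 A f ω₀ φ₀ δ α lam₀)
    (hf3 : HypF3 A f ω₀ φ₀ δ α lam₀) (hg : MemLp g ∞ volume)
    (hfg : ∃ C : ℝ, ∃ r > 0, ∀ᵐ x : Rd d, ∀ z : ℂ, ‖z‖ < r →
      ‖f x ω₀ z - g x * ((‖z‖ ^ (1 / α) : ℝ) : ℂ) * z‖ ≤ C * ‖z‖ ^ (1 / α + 1 + β))
    (S : L2 d →L[ℂ] ℂ × GraphDomain A) {c : ℝ} (hc : ‖S (leading g α φ₀)‖ < c)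
    (hτ : 0 < τ) (hτ1 : τ ≤ 1) (hτβ : τ ≤ α * β) :
    ∃ r > 0, ∀ᶠ ε in 𝓝[>] (0 : ℝ),
      Metric.ball (ε • S (leading g α φ₀)) (r * ε ^ (1 + τ)) ⊆ Metric.closedBall 0 (c * ε) ∧
      ∃! p, p ∈ Metric.ball (ε • S (leading g α φ₀)) (r * ε ^ (1 + τ)) ∧
        S (reducedRhs W f ω₀ φ₀ (ε ^ α) p) = p := by
  have : CompleteSpace (GraphDomain A) := GraphDomain.completeSpace hclosed
  obtain ⟨C₁, hC₁, hlip⟩ := exists_norm_reducedRhs_sub_le hδ hα hlam₀ hW1 hf1 hf2 hf3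
    ((norm_nonneg _).trans_lt hc)
  obtain ⟨C₂, hzero⟩ := exists_norm_reducedRhs_zero_sub_le (W := W) hδ hα hβ hφ₀ hf1 hg hfg
  refine exists_radius_existsUnique_fixedPoint hc (C := ‖S‖ * max C₁ C₂) (by positivity) hτ hτ1
    hτβ ?_ ?_
  · filter_upwards [hlip, self_mem_nhdsWithin] with ε hε hε0 p hp p' hp'
    have hε0' : 0 < ε := hε0
    rw [← map_sub]
    calc _ ≤ ‖S‖ * (C₁ * ε * ‖p - p'‖) := S.le_opNorm_of_le (hε p hp p' hp')
      _ ≤ ‖S‖ * (max C₁ C₂ * ε * ‖p - p'‖) := by gcongr; exact le_max_left _ _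
      _ = _ := by ring
  · filter_upwards [hzero, self_mem_nhdsWithin] with ε hε hε0
    have hε0' : 0 < ε := hε0
    rw [← Complex.coe_smul, ← map_smul, ← map_sub]
    calc _ ≤ ‖S‖ * (C₂ * ε ^ (1 + α * β)) := S.le_opNorm_of_le hε
      _ ≤ ‖S‖ * (max C₁ C₂ * ε ^ (1 + α * β)) := by gcongr; exact le_max_right _ _
      _ = _ := by ring

end Main

end

end NLEig

open NLEig Filter Topology in
theorem theorem1_general {d : ℕ} (A : Op d) (W : Rd d → ℂ → ℂ)
    (f : Rd d → ℂ → ℂ → ℂ) (g : ℂ → Rd d → ℂ) (ω₀ : ℂ) (φ₀ : A.domain) (φs : L2 d)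
    (δ α β lam₀ : ℝ) (hδ : 0 < δ) (hα : 0 < α) (hβ : 0 < β) (hlam₀ : 0 < lam₀)
    (hdense : Dense (A.domain : Set (L2 d))) (hclosed : A.IsClosed)
    (hφ₀ : MemLp (φ₀ : L2 d) ∞ volume) (hW1 : HypW1 W ω₀ δ)
    (hker : {u : L2 d | ∃ h : u ∈ (linOp A W ω₀).domain, linOp A W ω₀ ⟨u, h⟩ = 0} =
      (Submodule.span ℂ {(φ₀ : L2 d)} : Set (L2 d)))
    (hres : ∃ᶠ ω in 𝓝 ω₀, InResolvent (linOp A W ω) 0)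
    (hrange : IsClosed (Set.range (linOp A W ω₀)))
    (hφs : ∃ h : φs ∈ (linOp A W ω₀)†.domain, (linOp A W ω₀)† ⟨φs, h⟩ = 0)
    (hnorm : pair (φ₀ : L2 d) φs = 1)
    (hWt : pair (mulOp (dW W ω₀) (φ₀ : L2 d)) φs ≠ 0)
    (hf1 : HypF1 A f ω₀ δ) (hf2 : HypF2 A f ω₀ φ₀ δ α lam₀) (hf3 : HypF3 A f ω₀ φ₀ δ α lam₀)
    (hg : MemLp (g ω₀) ∞ volume)
    (hfg : ∃ C : ℝ, ∃ r > 0, ∀ᵐ x : Rd d, ∀ z : ℂ, ‖z‖ < r →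
      ‖f x ω₀ z - g ω₀ x * ((‖z‖ ^ (1 / α) : ℝ) : ℂ) * z‖ ≤ C * ‖z‖ ^ (1 / α + 1 + β)) :
    ∃ ϕ : A.domain,
      (∀ η : A.domain,
        (pair (η : L2 d) φs = 0 ∧
          linOp A W ω₀ η = leading (g ω₀) α φ₀ +
            nu W g α ω₀ φ₀ φs • mulOp (dW W ω₀) (φ₀ : L2 d)) ↔ η = ϕ) ∧
      ∀ τ : ℝ, 0 < τ → τ ≤ min 1 (α * β) →
        ∃ r₁ > 0, ∃ r₂ > 0, ∃ ε₀ > 0, ∀ ε : ℝ, 0 < ε → ε < ε₀ →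
          ∃! p : ℂ × L2 d,
            Solves A W f p.1 p.2 ∧
            pair p.2 φs = ((ε ^ α : ℝ) : ℂ) ∧
            HasExpansion A ω₀ (nu W g α ω₀ φ₀ φs) φ₀ φs ϕ α τ r₁ r₂ ε p.1 p.2 := by
  have hker' := linOp_eq_zero_iff hker
  have hLφ₀ : linOp A W ω₀ φ₀ = 0 := (hker' φ₀).2 ⟨1, one_smul ℂ φ₀⟩
  obtain ⟨S, hS⟩ := exists_linearizedSolver hδ hdense hclosed hW1 hker' hres hrange hφs hnorm hWt
  obtain ⟨ν, ϕ, hq⟩ : ∃ (ν : ℂ) (ϕ : A.domain),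
      S (leading (g ω₀) α φ₀) = (ν, GraphDomain.ofDomain A ϕ) := ⟨_, _, rfl⟩
  obtain rfl : ν = nu W g α ω₀ φ₀ φs :=
    eq_nu_of_linearized (pair_linOp_eq_zero hdense hφs) hWt ((hS _ _).1 hq).1
  refine ⟨ϕ, fun η => ?_, fun τ hτ hτle => ?_⟩
  · rw [← solver_leading_eq_iff hS, hq, Prod.mk_right_inj, EmbeddingLike.apply_eq_iff_eq, eq_comm]
  obtain ⟨hτ1, hτβ⟩ := le_min_iff.1 hτle
  obtain ⟨r, hr, hfix⟩ := exists_radius_existsUnique_reduced hδ hα hβ hlam₀ hclosed hφ₀ hW1 hf1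
    hf2 hf3 hg hfg S (lt_add_one _) hτ hτ1 hτβ
  obtain ⟨ε₀, hε₀, hsol⟩ := mem_nhdsGT_iff_exists_Ioo_subset.1
    (hfix.and (eventually_memLp_unscale (φ₀ := φ₀) hδ hα hf1 _))
  refine ⟨r, hr, r, hr, ε₀, hε₀, fun ε hε hlt => ?_⟩
  obtain ⟨⟨hball, p, hp, huniq⟩, hmem⟩ := hsol ⟨hε, hlt⟩
  rw [hq] at hball hp huniq
  have hiff := isSolution_iff_exists_fixedPoint hδ hW1 hLφ₀ hnorm hS hε ((hS _ _).1 hq).2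
    fun p hp => hmem p (hball hp)
  refine ⟨_, (hiff _).2 ⟨p, hp, rfl⟩, fun y hy => ?_⟩
  obtain ⟨p', hp', rfl⟩ := (hiff y).1 hy
  rw [huniq p' hp']

theorem theorem1 {d : ℕ} (A : NLEig.Op d) (W : NLEig.Rd d → ℂ → ℂ)
    (f : NLEig.Rd d → ℂ → ℂ → ℂ) (g : ℂ → NLEig.Rd d → ℂ)
    (ω₀ : ℂ) (φ₀ : A.domain) (φs : NLEig.L2 d)
    (δ α β lam₀ : ℝ) (hδ : 0 < δ) (hα : 0 < α) (hβ : 0 < β) (hlam₀ : 0 < lam₀)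
    (hA1 : NLEig.HypA1 A) (hA2 : NLEig.HypA2 A) (hW1 : NLEig.HypW1 W ω₀ δ)
    -- `ω₀` is an algebraically simple, isolated eigenvalue, and `L(·, ω₀)` has closed range
    (hsimple : NLEig.AlgSimple (NLEig.linOp A W ω₀) (φ₀ : NLEig.L2 d))
    (hisol : NLEig.Isolated A W ω₀)
    (hrange : IsClosed (Set.range (NLEig.linOp A W ω₀)))
    -- normalized eigenfunctions of `L(·, ω₀)` and of its adjoint
    (hφ₀ : ‖(φ₀ : NLEig.L2 d)‖ = 1)
    (hφs : ∃ h : φs ∈ (NLEig.linOp A W ω₀)†.domain, (NLEig.linOp A W ω₀)† ⟨φs, h⟩ = 0)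
    (hnorm : NLEig.pair (φ₀ : NLEig.L2 d) φs = 1)
    (hWt : NLEig.pair (NLEig.mulOp (NLEig.dW W ω₀) (φ₀ : NLEig.L2 d)) φs ≠ 0)
    (hf1 : NLEig.HypF1 A f ω₀ δ) (hf2 : NLEig.HypF2 A f ω₀ φ₀ δ α lam₀)
    (hf3 : NLEig.HypF3 A f ω₀ φ₀ δ α lam₀) (hf4 : NLEig.HypF4 f g ω₀ δ α β) :
    -- `ϕ` is the unique element of `D(A) ∩ ⟨φ₀*⟩^⊥` with
    -- `L(·, ω₀) ϕ = g_{ω₀}|φ₀|^{1/α} φ₀ + ν ∂_ω W(·, ω₀) φ₀`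
    ∃ ϕ : A.domain,
      (∀ η : A.domain,
        (NLEig.pair (η : NLEig.L2 d) φs = 0 ∧
          NLEig.linOp A W ω₀ η = NLEig.leading (g ω₀) α φ₀ +
            NLEig.nu W g α ω₀ φ₀ φs • NLEig.mulOp (NLEig.dW W ω₀) (φ₀ : NLEig.L2 d)) ↔ η = ϕ) ∧
      ∀ τ : ℝ, 0 < τ → τ ≤ min 1 (α * β) →
        ∃ r₁ > 0, ∃ r₂ > 0, ∃ ε₀ > 0, ∀ ε : ℝ, 0 < ε → ε < ε₀ →
          ∃! p : ℂ × NLEig.L2 d,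
            NLEig.Solves A W f p.1 p.2 ∧
            NLEig.pair p.2 φs = ((ε ^ α : ℝ) : ℂ) ∧
            NLEig.HasExpansion A ω₀ (NLEig.nu W g α ω₀ φ₀ φs) φ₀ φs ϕ α τ r₁ r₂ ε p.1 p.2 := by
  obtain ⟨C, r, hr, hfg⟩ := hf4.2.1
  exact theorem1_general A W f g ω₀ φ₀ φs δ α β lam₀ hδ hα hβ hlam₀ hA1.1 hA1.2.1
    (hA2.memLp_top φ₀) hW1 hsimple.1 hisol.frequently_inResolvent hrange hφs hnorm hWt hf1 hf2 hf3
    (hf4.1 ω₀ (Metric.mem_ball_self hδ)).1 ⟨C, r, hr, hfg ω₀ (Metric.mem_ball_self hδ)⟩
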